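/- **Setting.** Let $\mathcal Y=\{y_1,\dots,y_m\}$, $m\ge 2$, and let $p$ be a probability distribution on $\mathcal Y$ with $p(y_1)>p(y_2)\ge\dots\ge p(y_m)\ge 0$. Let $(Y_r)_{r\ge1}$ be i.i.d. samples of law $p$. The samples are accessed only through queries, each of which reveals whether a chosen sample belongs to a chosen subset of $\mathcal Y$. **Algorithm (Elimination), with parameter $\delta>0$.** Start with $S_e=\emptyset$, $r=0$ and $N(y)=0$ for all $y\in\mathcal Y$. While $\mathcal Y\setminus S_e$ is not a singleton, increase $r$ by one and use one query to test whether $Y_r\in S_e$. If $Y_r\notin S_e$: 1. identify $Y_r$ by going down a Huffman tree on $\mathcal Y\setminus S_e$ built for the current counts $N$ (ties in the Huffman construction are broken in an arbitrary way, which may depend on the past samples); this costs one query per edge from the root to the leaf of $Y_r$; 2. increase $N(Y_r)$ by one, and set $\hat p_r(y)=N(y)/r$ for $y\notin S_e$ and $\hat p_r(y)=0$ for $y\in S_e$; 3. add to $S_e$ all $y\in\mathcal Y\setminus S_e$ such that $\hat p_r(y)+\sigma_y(r,\hat p_r)<\max_{z\in\mathcal Y\setminus S_e}\hat p_r(z)$,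 where $$\sigma_y(r,\hat p)=\sqrt{\frac{24\,\max_z\hat p(z)\,\ln(\pi^2mr^2/\delta)}{r}} .$$ When the loop ends, return the unique element of $\mathcal Y\setminus S_e$. Let $T\in[0,\infty]$ be the total number of queries made. **Theorem.** For every $\delta>0$, with probability at least $1-\delta$ the algorithm terminates and returns $y_1$; call this event $B_\delta$. Moreover, there are universal constants $C_1,C_2>0$ such that for every $m$ and $p$ as above and every $\delta\in(0,1)$, $$\frac{\mathbb E[T\mid B_\delta]}{\ln(1/\delta)}\le C_1\frac{p(y_1)}{\nabla_2^2}+C_2\sum_{i=1}^m p(y_i)\,\frac{p(y_1)}{\nabla_i^2}\left\lceil\log_2\frac1{p(y_i)}\right\rceil+o(1)\qquad(\delta\to0),$$ where $\nabla_i=p(y_1)-p(y_i)$ for $i\ne1$, $\nabla_1=\nabla_2$, terms with $p(y_i)=0$ are $0$, and the $o(1)$ term is a function of $\delta$ that depends only on $m$ and $p$ and tends to $0$ as $\delta\to0$. -/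

import Mathlib

open MeasureTheory ProbabilityTheory Filter Topology
open scoped ENNReal

/-! ### Binary trees, Huffman trees and the cost of identifying a sample -/

/-- Binary trees whose leaves carry elements of `α`. -/
inductive BinTree (α : Type*) where
  | leaf (a : α) : BinTree α
  | node (l r : BinTree α) : BinTree α

namespace BinTree

variable {α : Type*}

/-- The set of elements sitting at the leaves. -/
def leaves [DecidableEq α] : BinTree α → Finset α
  | leaf a => {a}
  | node l r => l.leaves ∪ r.leaves

/-- The value of a vertex: the count of a leaf, the sum of the children's values at a node. -/
def value (N : α → ℕ) : BinTree α → ℕ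
  | leaf a => N a
  | node l r => l.value N + r.value N

/-- The number of queries spent to identify a sample equal to `a` by going down the tree: at a
node one asks whether the sample belongs to the right subtree, and moves to the corresponding
child. For an element at the leaves this is its depth, the length of its code. -/
def identifyQueries [DecidableEq α] (a : α) : BinTree α → ℕ
  | leaf _ => 0
  | node l r => 1 + if a ∈ r.leaves then r.identifyQueries a else l.identifyQueries a

end BinTree

/-- One step of the Huffman scheme for the counts `N`: two vertices of smallest value are taken
out of the heap, merged under a new node, and this node is put back.
Ties may be broken in any way. -/
inductive HuffmanStep {α : Type*} (N : α → ℕ) :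
    Multiset (BinTree α) → Multiset (BinTree α) → Prop
  | merge (V₁ V₂ : BinTree α) (F : Multiset (BinTree α))
      (h₁₂ : V₁.value N ≤ V₂.value N) (hF : ∀ V ∈ F, V₂.value N ≤ V.value N) :
      HuffmanStep N (V₁ ::ₘ V₂ ::ₘ F) (BinTree.node V₁ V₂ ::ₘ F)

/-- `t` is a Huffman tree on the set `A` for the counts `N`: the Huffman scheme, started from the
heap of the leaves `y ∈ A`, may end with the one-element heap `{t}`. -/
def IsHuffmanTree {α : Type*} (N : α → ℕ) (A : Finset α) (t : BinTree α) : Prop :=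
  Relation.ReflTransGen (HuffmanStep N) (A.val.map BinTree.leaf) {t}

/-! ### The Elimination algorithm -/

namespace Elimination

variable {𝒴 : Type*} [Fintype 𝒴] [DecidableEq 𝒴]

/-- The variables of the algorithm: round counter `r`, counts `N`, eliminated classes `S_e`. -/
structure State (𝒴 : Type*) where
  round : ℕ
  count : 𝒴 → ℕ
  eliminated : Finset 𝒴

/-- The classes that are still candidates, `𝒴 \ S_e`. -/
def State.active (s : State 𝒴) : Finset 𝒴 := s.eliminatedᶜ

/-- The loop stops as soon as `𝒴 \ S_e` is a singleton. -/
def State.Finished (s : State 𝒴) : Prop := s.active.card = 1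

/-- The empirical frequencies `N(y) / r` of the candidate classes, extended by `0` on `S_e`. -/
noncomputable def State.freq (s : State 𝒴) (y : 𝒴) : ℝ :=
  if y ∈ s.eliminated then 0 else (s.count y : ℝ) / (s.round : ℝ)

/-- A schedule `σ_y(r, q)`, written `σ r q y`. -/
abbrev Schedule (𝒴 : Type*) := ℕ → (𝒴 → ℝ) → 𝒴 → ℝ

/-- The state before the first round. -/
def State.init : State 𝒴 := ⟨0, fun _ => 0, ∅⟩

/-- The new sample `y` of a round has been identified: the round counter and the count of `y`
are increased. -/
def State.record (s : State 𝒴) (y : 𝒴) : State 𝒴 :=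
  { s with round := s.round + 1, count := Function.update s.count y (s.count y + 1) }

open Classical in
/-- All candidates `y` with `p̂_r(y) + σ_y(r, p̂_r) < max_{z ∈ 𝒴 \ S_e} p̂_r(z)` are eliminated. -/
noncomputable def State.eliminate (σ : Schedule 𝒴) (s : State 𝒴) : State 𝒴 :=
  { s with
    eliminated := s.eliminated ∪
      s.active.filter (fun y => ∃ z ∈ s.active, s.freq y + σ s.round s.freq y < s.freq z) }

open Classical in
/-- One round of the algorithm, with new sample `y`. Nothing happens after termination. -/
noncomputable def step (σ : Schedule 𝒴) (s : State 𝒴) (y : 𝒴) : State 𝒴 :=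
  if s.Finished then s
  else if y ∈ s.eliminated then { s with round := s.round + 1 }
  else (s.record y).eliminate σ

/-- The state after `r` rounds, on the sample sequence `y`; the sample of round `r + 1`
is `y r`. -/
noncomputable def run (σ : Schedule 𝒴) (y : ℕ → 𝒴) : ℕ → State 𝒴
  | 0 => State.init
  | r + 1 => step σ (run σ y r) (y r)

/-- The algorithm terminates and returns `ŷ`. -/
def Returns (σ : Schedule 𝒴) (y : ℕ → 𝒴) (ŷ : 𝒴) : Prop :=
  ∃ r, (run σ y r).active = {ŷ}

/-- A rule that selects the tree used in round `r + 1` from the `r` samples of the previous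
rounds. -/
abbrev TreeRule (𝒴 : Type*) := (r : ℕ) → (Fin r → 𝒴) → BinTree 𝒴

/-- The rule always selects a Huffman tree adapted to the current counts on the current set of
candidates. -/
def IsHuffmanRule (σ : Schedule 𝒴) (τ : TreeRule 𝒴) : Prop :=
  ∀ (y : ℕ → 𝒴) (r : ℕ),
    IsHuffmanTree (run σ y r).count (run σ y r).active (τ r (fun i => y i))

open Classical in
/-- The number of queries of round `r + 1`: none after termination; otherwise one query to test
whether the sample belongs to `S_e` and, if it does not, the queries that identify it in the
tree. -/
noncomputable def roundQueries (σ : Schedule 𝒴) (τ : TreeRule 𝒴) (y : ℕ → 𝒴) (r : ℕ) : ℕ :=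
  if (run σ y r).Finished then 0
  else if y r ∈ (run σ y r).eliminated then 1
  else 1 + (τ r (fun i => y i)).identifyQueries (y r)

/-- The total number of queries consumed by the algorithm (infinite without termination). -/
noncomputable def totalQueries (σ : Schedule 𝒴) (τ : TreeRule 𝒴) (y : ℕ → 𝒴) : ℝ≥0∞ :=
  ∑' r, (roundQueries σ τ y r : ℝ≥0∞)

/-- The schedule `σ_y(r, q) = √(24 · max_z q(z) · ln(π² m r² / δ) / r)`, `m` the number of
classes. -/
noncomputable def schedule (𝒴 : Type*) [Fintype 𝒴] (δ : ℝ) : Schedule 𝒴 := fun r q _ =>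
  Real.sqrt (24 * (⨆ z, q z) *
    Real.log (Real.pi ^ 2 * (Fintype.card 𝒴 : ℝ) * (r : ℝ) ^ 2 / δ) / (r : ℝ))

end Elimination

/-- The gaps: with classes `y₁, …, y_m` numbered from `0` to `m - 1`, the gap of `y_i` is
`p(y₁) - p(y_i)` for `i ≠ 1`, and the gap of `y₁` is that of `y₂`. -/
def modeGap {m : ℕ} (hm : 2 ≤ m) (p : Fin m → ℝ) (i : Fin m) : ℝ :=
  if i = ⟨0, by omega⟩ then p ⟨0, by omega⟩ - p ⟨1, by omega⟩ else p ⟨0, by omega⟩ - p i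

/-! Write `b` for the most likely class, `L` for the logarithm in the schedule and `N` for sample
counts.

Correctness. If `z` eliminates `b` at time `n`, then `(N z - N b)² > 24 L N z ≥ 12 L (N z + N b)`: a
deviation measured against the number of samples falling in `{z, b}`, not against `n`. Since `p z ≤
p b` and `cosh l ≤ exp (l² / 2)`, the variable `exp (l (N z - N b) - l² (N z + N b) / 2)` has mean
at most 1. Markov's inequality, with `l` tuned to each possible value of `N z + N b`, bounds the
event by `δ / (π² m n²)`, and these bounds sum to `δ / 6` (`measure_exists_overtakes_le`).

Number of rounds. While the empirical frequencies are within a small `η` of `p`, the class `a` fails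
the test as soon as `192 p(b) L < n (p(b) - p(a))²`. The test runs only in rounds whose sample is a
candidate, but `b` is always one and appears between rounds `r / 2` and `r`, so `a` is gone by a
deterministic time `2 t a` unless the run has ended (`finished_or_mem_eliminated`).

Cost of a round. In a Huffman tree values double at least every two levels, so a class of frequency
about `p a` has depth at most `2 ⌈log₂ (1 / p a)⌉ + 3` (`IsHuffmanRule.identifyQueries_le`).

Expectation. In a typical round the cost is bounded by a function of `r` and of the fresh sample
only, so its mean is explicit. Atypical rounds cost at most `m + 1` queries, and by Hoeffding their
expected number is bounded independently of `δ`. Conditioning on success costs a factor `1 / (1 -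
δ)`, absorbed in the error term. -/

namespace BinTree

/-! ### Depth of the leaves of a Huffman tree -/

variable {α : Type*}

/-- The number of inner vertices. -/
def nodeCount : BinTree α → ℕ
  | leaf _ => 0
  | node l r => l.nodeCount + r.nodeCount + 1

/-- The children of the root. -/
def children : BinTree α → Set (BinTree α)
  | leaf _ => ∅
  | node l r => {l, r}

lemma identifyQueries_le_nodeCount [DecidableEq α] (a : α) (t : BinTree α) :
    t.identifyQueries a ≤ t.nodeCount := by
  induction t with
  | leaf b => simp [identifyQueries]
  | node l r hl hr =>
    simp only [identifyQueries, nodeCount]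
    split_ifs <;> omega

/-- Every element at the leaves has its value doubled for each two levels above it. -/
def DepthBounded [DecidableEq α] (N : α → ℕ) (t : BinTree α) : Prop :=
  ∀ a ∈ t.leaves, 2 ^ (t.identifyQueries a / 2) * N a ≤ t.value N

lemma DepthBounded.leaf [DecidableEq α] (N : α → ℕ) (a : α) : (leaf a).DepthBounded N := by
  intro b hb
  simp only [leaves, Finset.mem_singleton] at hb
  simp [identifyQueries, value, hb]

/-- `M` is the value of the future sibling of `V`. A child of `V` lies two levels below the new
root, and its value is at most both `V.value N` and `M`, so the root is worth at least twice the
child. -/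
lemma two_pow_succ_mul_le [DecidableEq α] {N : α → ℕ} {V : BinTree α} {M : ℕ}
    (hV : V.DepthBounded N)
    (hc : ∀ c ∈ V.children, c.DepthBounded N ∧ c.value N ≤ V.value N ∧ c.value N ≤ M)
    {a : α} (ha : a ∈ V.leaves) :
    2 ^ ((1 + V.identifyQueries a) / 2) * N a ≤ V.value N + M := by
  have key : ∀ c ∈ V.children, a ∈ c.leaves → V.identifyQueries a = 1 + c.identifyQueries a →
      2 ^ ((1 + V.identifyQueries a) / 2) * N a ≤ V.value N + M := by
    intro c hcV hac h
    obtain ⟨h1, h2, h3⟩ := hc c hcV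
    have := h1 a hac
    rw [h, show (1 + (1 + c.identifyQueries a)) / 2 = c.identifyQueries a / 2 + 1 by omega,
      pow_succ]
    linarith
  cases V with
  | leaf b =>
    have := hV a ha
    simp only [identifyQueries] at this ⊢
    norm_num at this ⊢
    omega
  | node l r =>
    by_cases h : a ∈ r.leaves
    · exact key r (by simp [children]) h (by simp [identifyQueries, h])
    · refine key l (by simp [children]) ?_ (by simp [identifyQueries, h])
      simpa [leaves, h] using ha

lemma DepthBounded.node [DecidableEq α] {N : α → ℕ} {V₁ V₂ : BinTree α}
    (h₁ : V₁.DepthBounded N) (h₂ : V₂.DepthBounded N)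
    (hc₁ : ∀ c ∈ V₁.children,
      c.DepthBounded N ∧ c.value N ≤ V₁.value N ∧ c.value N ≤ V₂.value N)
    (hc₂ : ∀ c ∈ V₂.children,
      c.DepthBounded N ∧ c.value N ≤ V₁.value N ∧ c.value N ≤ V₂.value N) :
    (node V₁ V₂).DepthBounded N := by
  intro a ha
  simp only [identifyQueries, value]
  split_ifs with h
  · rw [add_comm (V₁.value N)]
    exact two_pow_succ_mul_le h₂ (fun c hc => ⟨(hc₂ c hc).1, (hc₂ c hc).2.2, (hc₂ c hc).2.1⟩) h
  · refine two_pow_succ_mul_le h₁ hc₁ ?_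
    simpa [leaves, h] using ha

end BinTree

/-- The properties of the heap that are preserved by the Huffman scheme. -/
structure HuffmanHeap {α : Type*} [DecidableEq α] (N : α → ℕ) (A : Finset α)
    (H : Multiset (BinTree α)) : Prop where
  sum_value : (H.map (fun V => V.value N)).sum = ∑ a ∈ A, N a
  sum_nodeCount : (H.map BinTree.nodeCount).sum + H.card = A.card
  exists_mem_leaves : ∀ a ∈ A, ∃ V ∈ H, a ∈ V.leaves
  depthBounded : ∀ V ∈ H, V.DepthBounded N
  children : ∀ V ∈ H, ∀ c ∈ V.children, c.DepthBounded N ∧ ∀ X ∈ H, c.value N ≤ X.value N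

lemma HuffmanHeap.init {α : Type*} [DecidableEq α] (N : α → ℕ) (A : Finset α) :
    HuffmanHeap N A (A.val.map BinTree.leaf) where
  sum_value := by simp [Multiset.map_map, Function.comp_def, BinTree.value]
  sum_nodeCount := by simp [Multiset.map_map, Function.comp_def, BinTree.nodeCount]
  exists_mem_leaves a ha := ⟨BinTree.leaf a, by simpa using ha, by simp [BinTree.leaves]⟩
  depthBounded V hV := by
    obtain ⟨a, -, rfl⟩ := Multiset.mem_map.1 hV
    exact .leaf N a
  children V hV := by
    obtain ⟨a, -, rfl⟩ := Multiset.mem_map.1 hV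
    simp [BinTree.children]

/-- The merged vertices are the two smallest, so as children they stay below everything left in the
heap. Older children stay below the new node because its value exceeds that of each part. -/
lemma HuffmanHeap.step {α : Type*} [DecidableEq α] {N : α → ℕ} {A : Finset α}
    {H H' : Multiset (BinTree α)} (h : HuffmanHeap N A H) (hs : HuffmanStep N H H') :
    HuffmanHeap N A H' := by
  obtain ⟨V₁, V₂, F, h₁₂, hF⟩ := hs
  have m₁ : V₁ ∈ V₁ ::ₘ V₂ ::ₘ F := by simp
  have m₂ : V₂ ∈ V₁ ::ₘ V₂ ::ₘ F := by simp
  have mF : ∀ V ∈ F, V ∈ V₁ ::ₘ V₂ ::ₘ F := fun V hV => by simp [hV]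
  have hc := h.children
  refine ⟨?_, ?_, ?_, ?_, ?_⟩
  · rw [← h.sum_value]; simp [BinTree.value, add_assoc]
  · rw [← h.sum_nodeCount]; simp [BinTree.nodeCount]; ring
  · intro a ha
    obtain ⟨V, hV, haV⟩ := h.exists_mem_leaves a ha
    simp only [Multiset.mem_cons] at hV
    rcases hV with rfl | rfl | hV
    · exact ⟨_, Multiset.mem_cons_self _ _, by simp [BinTree.leaves, haV]⟩
    · exact ⟨_, Multiset.mem_cons_self _ _, by simp [BinTree.leaves, haV]⟩
    · exact ⟨V, by simp [hV], haV⟩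
  · intro V hV
    rcases Multiset.mem_cons.1 hV with rfl | hV
    · exact .node (h.depthBounded _ m₁) (h.depthBounded _ m₂)
        (fun c hcV => ⟨(hc _ m₁ c hcV).1, (hc _ m₁ c hcV).2 _ m₁, (hc _ m₁ c hcV).2 _ m₂⟩)
        (fun c hcV => ⟨(hc _ m₂ c hcV).1, (hc _ m₂ c hcV).2 _ m₁, (hc _ m₂ c hcV).2 _ m₂⟩)
    · exact h.depthBounded _ (mF _ hV)
  · intro V hV c hcV
    rcases Multiset.mem_cons.1 hV with rfl | hV
    · simp only [BinTree.children, Set.mem_insert_iff, Set.mem_singleton_iff] at hcV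
      rcases hcV with rfl | rfl
      · refine ⟨h.depthBounded _ m₁, fun X hX => ?_⟩
        rcases Multiset.mem_cons.1 hX with rfl | hX
        · simp [BinTree.value]
        · exact h₁₂.trans (hF _ hX)
      · refine ⟨h.depthBounded _ m₂, fun X hX => ?_⟩
        rcases Multiset.mem_cons.1 hX with rfl | hX
        · simp [BinTree.value]
        · exact hF _ hX
    · refine ⟨(hc _ (mF _ hV) c hcV).1, fun X hX => ?_⟩
      rcases Multiset.mem_cons.1 hX with rfl | hX
      · exact ((hc _ (mF _ hV) c hcV).2 _ m₁).trans (by simp [BinTree.value])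
      · exact (hc _ (mF _ hV) c hcV).2 _ (mF _ hX)

lemma IsHuffmanTree.heap {α : Type*} [DecidableEq α] {N : α → ℕ} {A : Finset α} {t : BinTree α}
    (h : IsHuffmanTree N A t) : HuffmanHeap N A {t} := by
  have : ∀ H, Relation.ReflTransGen (HuffmanStep N) (A.val.map BinTree.leaf) H →
      HuffmanHeap N A H := by
    intro H hH
    induction hH with
    | refl => exact .init N A
    | tail _ hs ih => exact ih.step hs
  exact this _ h

/-- The crude bound, used when nothing is known about the counts: a depth is at most the number of
inner vertices, one less than the number of leaves. -/
lemma IsHuffmanTree.identifyQueries_le_card {α : Type*} [DecidableEq α] {N : α → ℕ}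
    {A : Finset α} {t : BinTree α} (h : IsHuffmanTree N A t) (a : α) :
    t.identifyQueries a ≤ A.card := by
  have := h.heap.sum_nodeCount
  have := t.identifyQueries_le_nodeCount a
  simp at *
  omega

lemma IsHuffmanTree.two_pow_mul_le {α : Type*} [DecidableEq α] {N : α → ℕ}
    {A : Finset α} {t : BinTree α} (h : IsHuffmanTree N A t) {a : α} (ha : a ∈ A) :
    2 ^ (t.identifyQueries a / 2) * N a ≤ ∑ b ∈ A, N b := by
  have hs := h.heap.sum_value
  obtain ⟨V, hV, haV⟩ := h.heap.exists_mem_leaves a ha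
  obtain rfl := Multiset.mem_singleton.1 hV
  have := h.heap.depthBounded V hV a haV
  simp at hs
  omega

namespace Elimination

variable {𝒴 : Type*} [Fintype 𝒴] [DecidableEq 𝒴]

/-! ### The states visited by the algorithm -/

/-- The number of occurrences of `a` among the first `n` samples. -/
def sampleCount (y : ℕ → 𝒴) (n : ℕ) (a : 𝒴) : ℕ :=
  ∑ k ∈ Finset.range n, if y k = a then 1 else 0

omit [Fintype 𝒴] in
lemma sampleCount_succ (y : ℕ → 𝒴) (n : ℕ) (a : 𝒴) :
    sampleCount y (n + 1) a = sampleCount y n a + if y n = a then 1 else 0 :=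
  Finset.sum_range_succ _ _

lemma sum_sampleCount (y : ℕ → 𝒴) (n : ℕ) : ∑ a, sampleCount y n a = n := by
  simp only [sampleCount]
  rw [Finset.sum_comm]
  simp

omit [Fintype 𝒴] in
lemma exists_eq_of_sampleCount_lt {y : ℕ → 𝒴} {h r : ℕ} {a : 𝒴} (hr : h ≤ r)
    (hlt : sampleCount y h a < sampleCount y r a) : ∃ k, h ≤ k ∧ k < r ∧ y k = a := by
  by_contra! hne
  refine hlt.ne (Finset.sum_subset (by simpa using hr) fun k hk hk' => ?_)
  simp only [Finset.mem_range, not_lt] at hk hk'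
  exact if_neg (hne k hk' hk)

lemma step_of_finished {σ : Schedule 𝒴} {s : State 𝒴} (h : s.Finished) (a : 𝒴) :
    step σ s a = s := if_pos h

lemma step_of_mem {σ : Schedule 𝒴} {s : State 𝒴} (h : ¬ s.Finished) {a : 𝒴}
    (ha : a ∈ s.eliminated) : step σ s a = { s with round := s.round + 1 } := by
  rw [step, if_neg h, if_pos ha]

lemma step_of_notMem {σ : Schedule 𝒴} {s : State 𝒴} (h : ¬ s.Finished) {a : 𝒴}
    (ha : a ∉ s.eliminated) : step σ s a = (s.record a).eliminate σ := by
  rw [step, if_neg h, if_neg ha]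

lemma eliminated_subset_step (σ : Schedule 𝒴) (s : State 𝒴) (a : 𝒴) :
    s.eliminated ⊆ (step σ s a).eliminated := by
  by_cases h : s.Finished
  · rw [step_of_finished h]
  · by_cases ha : a ∈ s.eliminated
    · rw [step_of_mem h ha]
    · rw [step_of_notMem h ha]
      exact Finset.subset_union_left

lemma eliminated_mono (σ : Schedule 𝒴) (y : ℕ → 𝒴) :
    Monotone fun r => (run σ y r).eliminated :=
  monotone_nat_of_le_succ fun r => eliminated_subset_step σ (run σ y r) (y r)

lemma run_eq_of_finished {σ : Schedule 𝒴} {y : ℕ → 𝒴} {r s : ℕ} (hrs : r ≤ s)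
    (h : (run σ y r).Finished) : run σ y s = run σ y r := by
  induction s, hrs using Nat.le_induction with
  | base => rfl
  | succ s _ ih => rw [run, ih, step_of_finished h]

lemma not_finished_of_le {σ : Schedule 𝒴} {y : ℕ → 𝒴} {r s : ℕ} (hrs : r ≤ s)
    (h : ¬ (run σ y s).Finished) : ¬ (run σ y r).Finished := fun hr =>
  h (by rwa [run_eq_of_finished hrs hr])

lemma run_congr {σ : Schedule 𝒴} {y y' : ℕ → 𝒴} {r : ℕ} (h : ∀ k < r, y k = y' k) :
    run σ y r = run σ y' r := by
  induction r with
  | zero => rfl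
  | succ r ih => rw [run, run, ih fun k hk => h k (by omega), h r (by omega)]

lemma round_run {σ : Schedule 𝒴} {y : ℕ → 𝒴} {r : ℕ} (h : ¬ (run σ y r).Finished) :
    (run σ y r).round = r := by
  induction r with
  | zero => rfl
  | succ r ih =>
    have h' := not_finished_of_le (Nat.le_succ r) h
    have := ih h'
    by_cases ha : y r ∈ (run σ y r).eliminated
    · rw [run, step_of_mem h' ha]; simp [this]
    · rw [run, step_of_notMem h' ha]; simp [State.eliminate, State.record, this]

omit [Fintype 𝒴] in
lemma count_record {s : State 𝒴} {y : ℕ → 𝒴} {r : ℕ} {a : 𝒴}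
    (h : s.count a = sampleCount y r a) :
    (s.record (y r)).count a = sampleCount y (r + 1) a := by
  rw [sampleCount_succ, ← h]
  by_cases hya : y r = a
  · simp [State.record, hya]
  · simp [State.record, Function.update_of_ne (Ne.symm hya), hya]

/-- Counts are frozen for eliminated classes and after termination; elsewhere they are the plain
sample counts, to which concentration applies. -/
lemma count_run {σ : Schedule 𝒴} {y : ℕ → 𝒴} {r : ℕ} (h : ¬ (run σ y r).Finished) {a : 𝒴}
    (ha : a ∉ (run σ y r).eliminated) : (run σ y r).count a = sampleCount y r a := by
  induction r with
  | zero => rfl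
  | succ r ih =>
    have h' := not_finished_of_le (Nat.le_succ r) h
    have ha' : a ∉ (run σ y r).eliminated := fun hm => ha (eliminated_mono σ y (Nat.le_succ r) hm)
    have := ih h' ha'
    by_cases hy : y r ∈ (run σ y r).eliminated
    · have hne : y r ≠ a := by rintro rfl; exact ha' hy
      rw [run, step_of_mem h' hy, sampleCount_succ, if_neg hne]
      simpa using this
    · rw [run, step_of_notMem h' hy]
      exact count_record this

lemma freq_record {σ : Schedule 𝒴} {y : ℕ → 𝒴} {r : ℕ} (h : ¬ (run σ y r).Finished) (a : 𝒴) :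
    ((run σ y r).record (y r)).freq a =
      if a ∈ (run σ y r).eliminated then 0 else (sampleCount y (r + 1) a : ℝ) / (r + 1 : ℕ) := by
  by_cases ha : a ∈ (run σ y r).eliminated
  · rw [if_pos ha]
    exact if_pos ha
  · rw [if_neg ha, State.freq, if_neg (by exact ha), count_record (count_run h ha)]
    simp [State.record, round_run h]

lemma mem_eliminate_iff {σ : Schedule 𝒴} {s : State 𝒴} {a : 𝒴} (ha : a ∉ s.eliminated) :
    a ∈ (s.eliminate σ).eliminated ↔
      ∃ z, z ∉ s.eliminated ∧ s.freq a + σ s.round s.freq a < s.freq z := by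
  simp [State.eliminate, State.active, ha]

lemma mem_eliminated_succ_iff {σ : Schedule 𝒴} {y : ℕ → 𝒴} {r : ℕ}
    (h : ¬ (run σ y r).Finished) (hy : y r ∉ (run σ y r).eliminated) {a : 𝒴}
    (ha : a ∉ (run σ y r).eliminated) :
    a ∈ (run σ y (r + 1)).eliminated ↔ ∃ z, z ∉ (run σ y r).eliminated ∧
      (sampleCount y (r + 1) a : ℝ) / (r + 1 : ℕ) +
        σ (r + 1) ((run σ y r).record (y r)).freq a <
      (sampleCount y (r + 1) z : ℝ) / (r + 1 : ℕ) := by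
  have hround : ((run σ y r).record (y r)).round = r + 1 := by simp [State.record, round_run h]
  rw [run, step_of_notMem h hy, mem_eliminate_iff (by exact ha), hround]
  refine exists_congr fun z => and_congr_right fun hz => ?_
  rw [freq_record h a, freq_record h z, if_neg ha, if_neg (by exact hz)]

/-! ### The most likely class survives -/

/-- The logarithmic factor of the schedule. -/
noncomputable def logFactor (𝒴 : Type*) [Fintype 𝒴] (δ : ℝ) (n : ℕ) : ℝ :=
  Real.log (Real.pi ^ 2 * (Fintype.card 𝒴 : ℝ) * (n : ℝ) ^ 2 / δ)

omit [DecidableEq 𝒴] in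
lemma sq_le_pi_sq_mul_div (h𝒴 : 1 ≤ Fintype.card 𝒴) {δ : ℝ} (hδ : 0 < δ) (hδ1 : δ ≤ 1)
    (n : ℕ) : (n : ℝ) ^ 2 ≤ Real.pi ^ 2 * (Fintype.card 𝒴 : ℝ) * (n : ℝ) ^ 2 / δ := by
  have h1 : (1 : ℝ) ≤ Real.pi ^ 2 := one_le_pow₀ (by linarith [Real.pi_gt_three])
  have h2 : (1 : ℝ) ≤ Fintype.card 𝒴 := by exact_mod_cast h𝒴
  rw [le_div_iff₀ hδ]
  nlinarith [sq_nonneg (n : ℝ), mul_le_mul h1 h2 zero_le_one (by positivity),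
    mul_le_mul_of_nonneg_left hδ1 (sq_nonneg (n : ℝ)),
    mul_le_mul_of_nonneg_right (mul_le_mul h1 h2 zero_le_one (by positivity)) (sq_nonneg (n : ℝ))]

omit [DecidableEq 𝒴] in
lemma logFactor_nonneg (h𝒴 : 1 ≤ Fintype.card 𝒴) {δ : ℝ} (hδ : 0 < δ) (hδ1 : δ ≤ 1) {n : ℕ}
    (hn : 1 ≤ n) : 0 ≤ logFactor 𝒴 δ n := by
  refine Real.log_nonneg (le_trans ?_ (sq_le_pi_sq_mul_div h𝒴 hδ hδ1 n))
  exact one_le_pow₀ (by exact_mod_cast hn)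

/-- Among the first `n` samples, `a` is ahead of `b` by more than the noise level. -/
def Overtakes (δ : ℝ) (y : ℕ → 𝒴) (b a : 𝒴) (n : ℕ) : Prop :=
  sampleCount y n b < sampleCount y n a ∧
    12 * ((sampleCount y n a : ℝ) + sampleCount y n b) * logFactor 𝒴 δ n <
      ((sampleCount y n a : ℝ) - sampleCount y n b) ^ 2

/-- Bounding the maximum in the schedule below by the frequency of the eliminating class `z` makes
the failed test a statement about the counts of `z` and `b` alone. -/
lemma notMem_eliminated_of_not_overtakes (h𝒴 : 1 ≤ Fintype.card 𝒴) {δ : ℝ} (hδ : 0 < δ)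
    (hδ1 : δ ≤ 1) {y : ℕ → 𝒴} {b : 𝒴} (h : ∀ n a, ¬ Overtakes δ y b a (n + 1)) (r : ℕ) :
    b ∉ (run (schedule 𝒴 δ) y r).eliminated := by
  induction r with
  | zero => simp [run, State.init]
  | succ r ih =>
    by_cases hf : (run (schedule 𝒴 δ) y r).Finished
    · rwa [run, step_of_finished hf]
    by_cases hy : y r ∈ (run (schedule 𝒴 δ) y r).eliminated
    · rwa [run, step_of_mem hf hy]
    rw [mem_eliminated_succ_iff hf hy ih]
    rintro ⟨z, hz, hlt⟩
    refine h r z ?_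
    have hL : 0 ≤ logFactor 𝒴 δ (r + 1) := logFactor_nonneg h𝒴 hδ hδ1 (by omega)
    have hn : (0 : ℝ) < (r + 1 : ℕ) := by positivity
    set n : ℕ := r + 1
    set q := ((run (schedule 𝒴 δ) y r).record (y r)).freq with hq
    have hqz : q z = (sampleCount y n z : ℝ) / n := by rw [hq, freq_record hf, if_neg hz]
    have hM : (sampleCount y n z : ℝ) / n ≤ ⨆ x, q x := by
      rw [← hqz]; exact le_ciSup (Set.finite_range q).bddAbove z
    have hs : Real.sqrt (24 * ((sampleCount y n z : ℝ) / n) * logFactor 𝒴 δ n / n) ≤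
        schedule 𝒴 δ n q b := by
      refine Real.sqrt_le_sqrt ?_
      change _ ≤ 24 * (⨆ z, q z) * logFactor 𝒴 δ n / n
      gcongr
    have hlt' : Real.sqrt (24 * ((sampleCount y n z : ℝ) / n) * logFactor 𝒴 δ n / n) <
        ((sampleCount y n z : ℝ) - sampleCount y n b) / n := by
      rw [sub_div]; linarith
    have hpos : 0 < ((sampleCount y n z : ℝ) - sampleCount y n b) / n :=
      (Real.sqrt_nonneg _).trans_lt hlt'
    have hD : (0 : ℝ) < (sampleCount y n z : ℝ) - sampleCount y n b := by
      rwa [div_pos_iff_of_pos_right hn] at hpos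
    rw [Real.sqrt_lt' hpos, div_pow, lt_div_iff₀ (by positivity)] at hlt'
    have e : 24 * ((sampleCount y n z : ℝ) / n) * logFactor 𝒴 δ n / n * (n : ℝ) ^ 2 =
        24 * sampleCount y n z * logFactor 𝒴 δ n := by
      field_simp
    rw [e] at hlt'
    refine ⟨by exact_mod_cast sub_pos.1 hD, lt_of_le_of_lt ?_ hlt'⟩
    -- Since `z` is ahead of `b`, `24 N(z) ≥ 12 (N(z) + N(b))`.
    exact mul_le_mul_of_nonneg_right (by linarith) hL

/-! ### Elimination of the other classes -/

/-- The empirical frequencies after `n` samples are not all within `η` of `p`. -/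
def Deviates (p : 𝒴 → ℝ) (η : ℝ) (y : ℕ → 𝒴) (n : ℕ) : Prop :=
  n = 0 ∨ ∃ j, n * η < |(sampleCount y n j : ℝ) - n * p j|

/-- The frequencies are not close to `p` at some time after about half of the first `r` rounds. -/
def DeviatesAfterHalf (p : 𝒴 → ℝ) (η : ℝ) (y : ℕ → 𝒴) (r : ℕ) : Prop :=
  ∃ k, r ≤ 2 * k + 1 ∧ Deviates p η y k

omit [Fintype 𝒴] in
lemma abs_sub_le_of_not_deviates {p : 𝒴 → ℝ} {η : ℝ} {y : ℕ → 𝒴} {n : ℕ}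
    (h : ¬ Deviates p η y n) (j : 𝒴) : |(sampleCount y n j : ℝ) - n * p j| ≤ n * η := by
  simp only [Deviates, not_or, not_exists, not_lt] at h
  exact h.2 j

omit [Fintype 𝒴] in
lemma pos_of_not_deviates {p : 𝒴 → ℝ} {η : ℝ} {y : ℕ → 𝒴} {n : ℕ}
    (h : ¬ Deviates p η y n) : 0 < n := by
  simp only [Deviates, not_or] at h
  omega

/-- The frequencies differ by at least `p b - p a - 2η ≥ (p b - p a) / 2`. The maximal frequency is
at most `2 p b`, so the radius is at most `√(48 p(b) L / n)`, and `192 = 4 · 48` makes it smaller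
than half the gap. -/
lemma mem_eliminated_succ {δ : ℝ} {p : 𝒴 → ℝ} {η : ℝ} {y : ℕ → 𝒴} {a b : 𝒴} {r : ℕ}
    (hpb : 0 < p b) (hmax : ∀ j, p j ≤ p b) (hη : 4 * η ≤ p b) (hηa : 4 * η ≤ p b - p a)
    (hf : ¬ (run (schedule 𝒴 δ) y r).Finished)
    (hb : b ∉ (run (schedule 𝒴 δ) y r).eliminated) (hy : y r = b)
    (hdev : ¬ Deviates p η y (r + 1)) (hL : 0 ≤ logFactor 𝒴 δ (r + 1))
    (hlarge : 192 * p b * logFactor 𝒴 δ (r + 1) < (r + 1 : ℕ) * (p b - p a) ^ 2)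
    (hab : p a < p b) :
    a ∈ (run (schedule 𝒴 δ) y (r + 1)).eliminated := by
  by_cases ha : a ∈ (run (schedule 𝒴 δ) y r).eliminated
  · exact eliminated_mono _ y (Nat.le_succ r) ha
  rw [mem_eliminated_succ_iff hf (hy ▸ hb) ha]
  refine ⟨b, hb, ?_⟩
  have hn : (0 : ℝ) < (r + 1 : ℕ) := by positivity
  have hfr := freq_record hf
  set n : ℕ := r + 1
  set q := ((run (schedule 𝒴 δ) y r).record (y r)).freq
  have hdev' := fun j => abs_le.1 (abs_sub_le_of_not_deviates hdev j)
  have : Nonempty 𝒴 := ⟨b⟩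
  have hM : ⨆ x, q x ≤ 2 * p b := by
    refine ciSup_le fun x => ?_
    rw [hfr x]
    split_ifs
    · positivity
    · rw [div_le_iff₀ hn]
      nlinarith [(hdev' x).2, mul_le_mul_of_nonneg_left (hmax x) hn.le,
        mul_le_mul_of_nonneg_left hη hn.le, mul_pos hn hpb]
  have hs : schedule 𝒴 δ n q a ≤ Real.sqrt (24 * (2 * p b) * logFactor 𝒴 δ n / n) := by
    refine Real.sqrt_le_sqrt ?_
    change 24 * (⨆ z, q z) * logFactor 𝒴 δ n / n ≤ _
    gcongr
  have hs' : Real.sqrt (24 * (2 * p b) * logFactor 𝒴 δ n / n) < (p b - p a) / 2 := by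
    rw [Real.sqrt_lt' (by linarith), div_lt_iff₀ hn]
    nlinarith
  have h1 : p b - η ≤ (sampleCount y n b : ℝ) / n := by
    rw [le_div_iff₀ hn]; nlinarith [(hdev' b).1]
  have h2 : (sampleCount y n a : ℝ) / n ≤ p a + η := by
    rw [div_le_iff₀ hn]; nlinarith [(hdev' a).2]
  linarith

/-- A round that samples an eliminated class performs no test. A round that samples `b` always does
before termination, so it suffices to find one in the second half of the first `r` rounds. -/
lemma finished_or_mem_eliminated (h𝒴 : 1 ≤ Fintype.card 𝒴) {δ : ℝ} (hδ : 0 < δ) (hδ1 : δ ≤ 1)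
    {p : 𝒴 → ℝ} {η : ℝ} {y : ℕ → 𝒴} {a b : 𝒴} {r : ℕ}
    (hpb : 0 < p b) (hmax : ∀ j, p j ≤ p b) (hη : 4 * η ≤ p b) (hηa : 4 * η ≤ p b - p a)
    (hb : ∀ r, b ∉ (run (schedule 𝒴 δ) y r).eliminated)
    (hdev : ¬ DeviatesAfterHalf p η y r)
    (hlarge : ∀ n : ℕ, r ≤ 2 * n + 1 → 192 * p b * logFactor 𝒴 δ n < n * (p b - p a) ^ 2)
    (hab : p a < p b) :
    (run (schedule 𝒴 δ) y r).Finished ∨ a ∈ (run (schedule 𝒴 δ) y r).eliminated := by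
  simp only [DeviatesAfterHalf, not_exists, not_and] at hdev
  have hdr := hdev r (by omega)
  have hdh := hdev (r / 2) (by omega)
  have hr0 : (0 : ℝ) < r := by exact_mod_cast pos_of_not_deviates hdr
  -- With `η ≤ p b / 4`, the count of `b` is at least `3/4 · r p(b)` at time `r`, and at most `5/4 ·
  -- (r / 2) p(b)` at time `r / 2`.
  have hlt : sampleCount y (r / 2) b < sampleCount y r b := by
    have h1 := (abs_le.1 (abs_sub_le_of_not_deviates hdr b)).1
    have h2 := (abs_le.1 (abs_sub_le_of_not_deviates hdh b)).2
    have h3 : ((r / 2 : ℕ) : ℝ) ≤ r / 2 := Nat.cast_div_le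
    have h4 : (0 : ℝ) ≤ (r / 2 : ℕ) := by positivity
    have : (sampleCount y (r / 2) b : ℝ) < sampleCount y r b := by
      nlinarith [mul_le_mul_of_nonneg_left hη hr0.le, mul_le_mul_of_nonneg_left hη h4,
        mul_pos hr0 hpb, mul_le_mul_of_nonneg_right h3 hpb.le]
    exact_mod_cast this
  obtain ⟨k, hk, hkr, hyk⟩ := exists_eq_of_sampleCount_lt (Nat.div_le_self r 2) hlt
  by_cases hf : (run (schedule 𝒴 δ) y k).Finished
  · left
    rwa [run_eq_of_finished hkr.le hf]
  · right
    exact eliminated_mono _ y hkr (mem_eliminated_succ hpb hmax hη hηa hf (hb k) hyk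
      (hdev (k + 1) (by omega)) (logFactor_nonneg h𝒴 hδ hδ1 (by omega))
      (hlarge (k + 1) (by omega)) hab)

lemma finished_of_forall_mem_eliminated {s : State 𝒴} {b : 𝒴} (hb : b ∉ s.eliminated)
    (h : ∀ a ≠ b, s.Finished ∨ a ∈ s.eliminated) : s.Finished := by
  by_contra hf
  refine hf ?_
  have : s.active = {b} := by
    ext a
    by_cases hab : a = b
    · simp [State.active, hab, hb]
    · simpa [State.active, hab] using (h a hab).resolve_left hf
  rw [State.Finished, this, Finset.card_singleton]

lemma active_eq_of_finished {s : State 𝒴} {b : 𝒴} (hb : b ∉ s.eliminated) (h : s.Finished) :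
    s.active = {b} := by
  obtain ⟨c, hc⟩ := Finset.card_eq_one.1 h
  have : b ∈ s.active := by simpa [State.active] using hb
  rw [hc, Finset.mem_singleton] at this
  rw [hc, this]

lemma Returns.notMem_eliminated {σ : Schedule 𝒴} {y : ℕ → 𝒴} {b : 𝒴} (h : Returns σ y b)
    (r : ℕ) : b ∉ (run σ y r).eliminated := by
  obtain ⟨s, hs⟩ := h
  have hb : b ∉ (run σ y s).eliminated := by
    have : b ∈ (run σ y s).active := by simp [hs]
    simpa [State.active] using this
  rcases le_total r s with hrs | hrs
  · exact fun hm => hb (eliminated_mono σ y hrs hm)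
  · rwa [run_eq_of_finished hrs (by rw [State.Finished, hs, Finset.card_singleton])]

/-! ### The number of queries of a round -/

/-- A bound for the queries that identify a sample in `a` in a typical round. -/
noncomputable def identifyBound (p : 𝒴 → ℝ) (a : 𝒴) : ℕ :=
  if p a = 0 then Fintype.card 𝒴 else 2 * ⌈Real.logb 2 (1 / p a)⌉₊ + 3

lemma IsHuffmanRule.identifyQueries_le_card {σ : Schedule 𝒴} {τ : TreeRule 𝒴}
    (hτ : IsHuffmanRule σ τ) (y : ℕ → 𝒴) (r : ℕ) (a : 𝒴) :
    (τ r (fun i => y i)).identifyQueries a ≤ Fintype.card 𝒴 :=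
  ((hτ y r).identifyQueries_le_card a).trans (Finset.card_le_univ _)

/-- The total value of the tree is at most `r` and the leaf has value at least `r p(a) / 2`, so `2 ^
(d / 2) ≤ 2 / p a` for the depth `d`. The additive 3 comes from this factor 2 and from the rounding
of `d / 2`. -/
lemma IsHuffmanRule.identifyQueries_le {σ : Schedule 𝒴} {τ : TreeRule 𝒴}
    (hτ : IsHuffmanRule σ τ) {y : ℕ → 𝒴} {r : ℕ} {p : 𝒴 → ℝ} {a : 𝒴} (hp0 : 0 ≤ p a)
    (hf : ¬ (run σ y r).Finished) (ha : a ∉ (run σ y r).eliminated) (hr : 0 < r)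
    (hcount : r * p a ≤ 2 * sampleCount y r a) :
    (τ r (fun i => y i)).identifyQueries a ≤ identifyBound p a := by
  rw [identifyBound]
  split_ifs with hpa
  · exact hτ.identifyQueries_le_card y r a
  have hpos : 0 < p a := lt_of_le_of_ne hp0 (Ne.symm hpa)
  have hr' : (0 : ℝ) < r := by exact_mod_cast hr
  set d := (τ r (fun i => y i)).identifyQueries a
  have h1 : 2 ^ (d / 2) * sampleCount y r a ≤ r := by
    calc 2 ^ (d / 2) * sampleCount y r a = 2 ^ (d / 2) * (run σ y r).count a := by
          rw [count_run hf ha]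
      _ ≤ ∑ b ∈ (run σ y r).active, (run σ y r).count b :=
          (hτ y r).two_pow_mul_le (by simpa [State.active] using ha)
      _ = ∑ b ∈ (run σ y r).active, sampleCount y r b :=
          Finset.sum_congr rfl fun b hb => count_run hf (by simpa [State.active] using hb)
      _ ≤ ∑ b, sampleCount y r b :=
          Finset.sum_le_sum_of_subset (Finset.subset_univ _)
      _ = r := sum_sampleCount y r
  have h2 : (2 : ℝ) ^ (d / 2) * sampleCount y r a ≤ r := by exact_mod_cast h1
  have h3 : (2 : ℝ) ^ (d / 2) ≤ 2 * (1 / p a) := by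
    rw [mul_one_div, le_div_iff₀ hpos]
    have hpow : (0 : ℝ) < 2 ^ (d / 2) := by positivity
    have : (r : ℝ) * (2 ^ (d / 2) * p a) ≤ r * 2 := by
      nlinarith [mul_le_mul_of_nonneg_left hcount hpow.le]
    exact le_of_mul_le_mul_left this hr'
  have h4 : ((d / 2 : ℕ) : ℝ) ≤ 1 + Real.logb 2 (1 / p a) := by
    have := Real.logb_le_logb_of_le one_lt_two (by positivity) h3
    rwa [Real.logb_mul two_ne_zero (by positivity), Real.logb_self_eq_one one_lt_two,
      Real.logb_pow, Real.logb_self_eq_one one_lt_two, mul_one] at this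
  have h5 : ((d / 2 : ℕ) : ℝ) ≤ 1 + ⌈Real.logb 2 (1 / p a)⌉₊ :=
    h4.trans (by gcongr; exact Nat.le_ceil _)
  have h6 : d / 2 ≤ 1 + ⌈Real.logb 2 (1 / p a)⌉₊ := by exact_mod_cast h5
  omega

lemma IsHuffmanRule.roundQueries_le_card {σ : Schedule 𝒴} {τ : TreeRule 𝒴}
    (hτ : IsHuffmanRule σ τ) (y : ℕ → 𝒴) (r : ℕ) :
    roundQueries σ τ y r ≤ Fintype.card 𝒴 + 1 := by
  have := hτ.identifyQueries_le_card y r (y r)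
  rw [roundQueries]
  split_ifs <;> omega

/-- The random eliminated set has left the bound: only the deterministic times `t` and the sample `y
r` remain, which makes the expectation computable. -/
lemma IsHuffmanRule.roundQueries_le (h𝒴 : 1 ≤ Fintype.card 𝒴) {δ : ℝ} (hδ : 0 < δ)
    (hδ1 : δ ≤ 1) {τ : TreeRule 𝒴} (hτ : IsHuffmanRule (schedule 𝒴 δ) τ)
    {p : 𝒴 → ℝ} {η : ℝ} {y : ℕ → 𝒴} {b : 𝒴} {r : ℕ} {t : 𝒴 → ℕ}
    (hp0 : ∀ a, 0 ≤ p a) (hmax : ∀ a ≠ b, p a < p b)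
    (hη : 4 * η ≤ p b) (hηa : ∀ a ≠ b, 4 * η ≤ p b - p a) (hηp : ∀ a, p a = 0 ∨ 2 * η ≤ p a)
    (hb : ∀ r, b ∉ (run (schedule 𝒴 δ) y r).eliminated)
    (hdev : ¬ DeviatesAfterHalf p η y r) (hpb : 0 < p b)
    (ht : ∀ a ≠ b, ∀ n : ℕ, t a ≤ n → 192 * p b * logFactor 𝒴 δ n < n * (p b - p a) ^ 2)
    (htb : ∀ a, t a ≤ t b) :
    roundQueries (schedule 𝒴 δ) τ y r ≤
      (if r < 2 * t b then 1 else 0) + if r < 2 * t (y r) then identifyBound p (y r) else 0 := by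
  have hmax' : ∀ j, p j ≤ p b := fun j => by
    by_cases hj : j = b
    · rw [hj]
    · exact (hmax j hj).le
  have helim : ∀ a ≠ b, 2 * t a ≤ r →
      (run (schedule 𝒴 δ) y r).Finished ∨ a ∈ (run (schedule 𝒴 δ) y r).eliminated :=
    fun a hab hr => finished_or_mem_eliminated h𝒴 hδ hδ1 hpb hmax' hη (hηa a hab) hb hdev
      (fun n hn => ht a hab n (by omega)) (hmax a hab)
  by_cases hf : (run (schedule 𝒴 δ) y r).Finished
  · rw [roundQueries, if_pos hf]; exact Nat.zero_le _
  have hrb : r < 2 * t b := by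
    by_contra! hr
    exact hf (finished_of_forall_mem_eliminated (hb r)
      fun a hab => helim a hab ((Nat.mul_le_mul_left 2 (htb a)).trans hr))
  by_cases hy : y r ∈ (run (schedule 𝒴 δ) y r).eliminated
  · rw [roundQueries, if_neg hf, if_pos hy, if_pos hrb]; exact Nat.le_add_right _ _
  have hry : r < 2 * t (y r) := by
    by_cases hyb : y r = b
    · rwa [hyb]
    · by_contra! hr
      exact ((helim _ hyb hr).resolve_left hf |> hy)
  rw [roundQueries, if_neg hf, if_neg hy, if_pos hrb, if_pos hry]
  have hd : ¬ Deviates p η y r := fun hd => hdev ⟨r, by omega, hd⟩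
  refine Nat.add_le_add_left (hτ.identifyQueries_le (hp0 _) hf hy (pos_of_not_deviates hd) ?_) 1
  rcases hηp (y r) with h0 | h0
  · rw [h0, mul_zero]; positivity
  · have := (abs_le.1 (abs_sub_le_of_not_deviates hd (y r))).1
    nlinarith [mul_le_mul_of_nonneg_left h0 (Nat.cast_nonneg (α := ℝ) r)]

end Elimination

namespace Elimination

/-! ### Independent samples -/

section Samples

variable {𝒴 : Type*} [Fintype 𝒴] [MeasurableSpace 𝒴] [MeasurableSingletonClass 𝒴]
  {Ω : Type*} [MeasurableSpace Ω] {P : Measure Ω} {Y : ℕ → Ω → 𝒴} {p : 𝒴 → ℝ}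

/-- There are finitely many prefixes of length `r`, so no measurability of `Q` is needed. -/
lemma measurableSet_of_forall_lt (hY : ∀ r, Measurable (Y r)) {Q : (ℕ → 𝒴) → Prop} {r : ℕ}
    (hQ : ∀ y y' : ℕ → 𝒴, (∀ k < r, y k = y' k) → Q y → Q y') :
    MeasurableSet {ω | Q fun k => Y k ω} := by
  have hm : Measurable fun ω (i : Fin r) => Y i ω := measurable_pi_lambda _ fun i => hY i
  have : {ω | Q fun k => Y k ω} =
      (fun ω (i : Fin r) => Y i ω) ⁻¹' {v | ∃ y : ℕ → 𝒴, (∀ i : Fin r, y i = v i) ∧ Q y} := by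
    ext ω
    constructor
    · exact fun h => ⟨fun k => Y k ω, fun _ => rfl, h⟩
    · rintro ⟨y, hy, hq⟩
      exact hQ y _ (fun k hk => hy ⟨k, hk⟩) hq
  rw [this]
  exact hm (Set.toFinite _).measurableSet

lemma integral_comp_sample [IsProbabilityMeasure P] (hY : ∀ r, Measurable (Y r))
    (hp : ∀ r i, P.real {ω | Y r ω = i} = p i) (f : 𝒴 → ℝ) (r : ℕ) :
    ∫ ω, f (Y r ω) ∂P = ∑ i, p i * f i := by
  have : IsProbabilityMeasure (P.map (Y r)) := Measure.isProbabilityMeasure_map (hY r).aemeasurable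
  rw [← integral_map (f := f) (hY r).aemeasurable (Measurable.of_discrete.aestronglyMeasurable),
    integral_fintype .of_finite]
  refine Finset.sum_congr rfl fun i _ => ?_
  rw [map_measureReal_apply (hY r) (measurableSet_singleton i), ← hp r i]
  rfl

lemma lintegral_comp_sample [IsProbabilityMeasure P] (hY : ∀ r, Measurable (Y r))
    (hp : ∀ r i, P.real {ω | Y r ω = i} = p i) (f : 𝒴 → ℝ≥0∞) (r : ℕ) :
    ∫⁻ ω, f (Y r ω) ∂P = ∑ i, ENNReal.ofReal (p i) * f i := by
  rw [← lintegral_map (f := f) Measurable.of_discrete (hY r), lintegral_fintype]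
  refine Finset.sum_congr rfl fun i _ => ?_
  rw [Measure.map_apply (hY r) (measurableSet_singleton i), ← hp r i, measureReal_def,
    ENNReal.ofReal_toReal (measure_ne_top _ _), mul_comm]
  rfl

lemma mgf_comp_sample [IsProbabilityMeasure P] (hY : ∀ r, Measurable (Y r))
    (hp : ∀ r i, P.real {ω | Y r ω = i} = p i) (f : 𝒴 → ℝ) (r : ℕ) :
    mgf (fun ω => f (Y r ω)) P 1 = ∑ i, p i * Real.exp (f i) := by
  simp only [mgf, one_mul]
  exact integral_comp_sample hY hp (fun i => Real.exp (f i)) r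

/-- Chernoff's bound with parameter 1, the multiplier being already inside `f`; by independence the
moment generating function of the sum is a product of factors at most 1. -/
lemma measureReal_le_exp_neg [IsProbabilityMeasure P] (hY : ∀ r, Measurable (Y r))
    (hindep : iIndepFun Y P) (hp : ∀ r i, P.real {ω | Y r ω = i} = p i) {f : 𝒴 → ℝ}
    (hf : ∑ i, p i * Real.exp (f i) ≤ 1) (n : ℕ) (c : ℝ) :
    P.real {ω | c ≤ ∑ k ∈ Finset.range n, f (Y k ω)} ≤ Real.exp (-c) := by
  have hfm : Measurable f := Measurable.of_discrete
  have hm : ∀ k, Measurable fun ω => f (Y k ω) := fun k => hfm.comp (hY k)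
  have hi : iIndepFun (fun k ω => f (Y k ω)) P := hindep.comp (fun _ => f) fun _ => hfm
  obtain ⟨B, hB⟩ := (Set.finite_range f).bddAbove
  have hB' : ∀ i, f i ≤ B := fun i => hB ⟨i, rfl⟩
  have hint : Integrable (fun ω => Real.exp (1 * (∑ k ∈ Finset.range n, fun ω => f (Y k ω)) ω)) P := by
    refine Integrable.of_bound (C := Real.exp (n * B)) ?_ (ae_of_all _ fun ω => ?_)
    · simp only [Finset.sum_apply]
      exact (Measurable.exp ((Finset.measurable_sum _ fun k _ => hm k).const_mul
        1)).aestronglyMeasurable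
    · rw [Real.norm_eq_abs, Real.abs_exp, one_mul, Finset.sum_apply, Real.exp_le_exp]
      refine (Finset.sum_le_card_nsmul _ _ B fun k _ => hB' _).trans ?_
      simp
  have := measure_ge_le_exp_mul_mgf (μ := P) c zero_le_one hint
  rw [hi.mgf_sum hm] at this
  have hprod : ∏ k ∈ Finset.range n, mgf (fun ω => f (Y k ω)) P 1 ≤ 1 :=
    Finset.prod_le_one (fun k _ => mgf_nonneg) fun k _ => by
      rw [mgf_comp_sample hY hp]; exact hf
  simp only [Finset.sum_apply] at this
  refine this.trans ?_
  rw [neg_one_mul]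
  exact mul_le_of_le_one_right (Real.exp_pos _).le hprod

variable [DecidableEq 𝒴]

/-! ### The probability that a class overtakes the most likely one -/

omit [Fintype 𝒴] [MeasurableSpace 𝒴] [MeasurableSingletonClass 𝒴] in
lemma sum_indicator_combination (y : ℕ → 𝒴) (a b : 𝒴) (l : ℝ) (n : ℕ) :
    ∑ k ∈ Finset.range n, (l * ((if y k = a then 1 else 0) - (if y k = b then 1 else 0)) -
        l ^ 2 / 2 * ((if y k = a then 1 else 0) + (if y k = b then 1 else 0))) =
      l * ((sampleCount y n a : ℝ) - sampleCount y n b) -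
        l ^ 2 / 2 * ((sampleCount y n a : ℝ) + sampleCount y n b) := by
  rw [Finset.sum_sub_distrib, ← Finset.mul_sum, ← Finset.mul_sum, Finset.sum_sub_distrib,
    Finset.sum_add_distrib]
  simp [sampleCount]

omit [MeasurableSpace 𝒴] [MeasurableSingletonClass 𝒴] in
lemma sum_mul_exp_combination_le_one (hp0 : ∀ i, 0 ≤ p i) (hp1 : ∑ i, p i = 1) {a b : 𝒴}
    (hne : a ≠ b) (hab : p a ≤ p b) {l : ℝ} (hl : 0 ≤ l) :
    ∑ i, p i * Real.exp (l * ((if i = a then 1 else 0) - (if i = b then 1 else 0)) -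
        l ^ 2 / 2 * ((if i = a then 1 else 0) + (if i = b then 1 else 0))) ≤ 1 := by
  rw [← Finset.add_sum_erase _ _ (Finset.mem_univ a),
    ← Finset.add_sum_erase _ _ (Finset.mem_erase.2 ⟨hne.symm, Finset.mem_univ b⟩)] at hp1 ⊢
  have hrest : ∑ i ∈ (Finset.univ.erase a).erase b,
      p i * Real.exp (l * ((if i = a then 1 else 0) - (if i = b then 1 else 0)) -
        l ^ 2 / 2 * ((if i = a then 1 else 0) + (if i = b then 1 else 0))) =
      ∑ i ∈ (Finset.univ.erase a).erase b, p i := by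
    refine Finset.sum_congr rfl fun i hi => ?_
    simp only [Finset.mem_erase] at hi
    simp [hi.1, hi.2.1]
  rw [hrest]
  simp only [if_true, hne, hne.symm, if_false]
  have hcosh := Real.cosh_le_exp_half_sq l
  rw [Real.cosh_eq] at hcosh
  have e1 : Real.exp (l * (1 - 0) - l ^ 2 / 2 * (1 + 0)) = Real.exp l * Real.exp (-(l ^ 2 / 2)) := by
    rw [← Real.exp_add]; ring_nf
  have e2 : Real.exp (l * (0 - 1) - l ^ 2 / 2 * (0 + 1)) =
      Real.exp (-l) * Real.exp (-(l ^ 2 / 2)) := by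
    rw [← Real.exp_add]; ring_nf
  rw [e1, e2]
  have hle : Real.exp (-l) ≤ Real.exp l := Real.exp_le_exp.2 (by linarith)
  have hpos := Real.exp_pos (-(l ^ 2 / 2))
  have hinv : Real.exp (l ^ 2 / 2) * Real.exp (-(l ^ 2 / 2)) = 1 := by
    rw [← Real.exp_add]; simp
  have h1 : Real.exp l * Real.exp (-(l ^ 2 / 2)) + Real.exp (-l) * Real.exp (-(l ^ 2 / 2)) ≤ 2 := by
    nlinarith [mul_le_mul_of_nonneg_right hcosh hpos.le]
  have h2 : Real.exp (-l) * Real.exp (-(l ^ 2 / 2)) ≤ Real.exp l * Real.exp (-(l ^ 2 / 2)) :=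
    mul_le_mul_of_nonneg_right hle hpos.le
  -- With `u = exp (l - l² / 2)` and `v = exp (-l - l² / 2)`, `p(a) u + p(b) v` equals `(p a + p
  -- b)(u + v) / 2 - (p b - p a)(u - v) / 2`, where `u + v ≤ 2` and `v ≤ u`.
  nlinarith [mul_nonneg (sub_nonneg.2 hab) (sub_nonneg.2 h2), hp0 a, hp0 b,
    mul_le_mul_of_nonneg_left h1 (add_nonneg (hp0 a) (hp0 b))]

-- Take `s = N(a) + N(b)` and `l = √(12 L / s)`. The quadratic term is then exactly `6 L`, and
-- overtaking makes the linear one at least `12 L`. As `s` is random, a union over its `n` possible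
-- values is needed.
omit [MeasurableSpace 𝒴] [MeasurableSingletonClass 𝒴] in
lemma Overtakes.exists_le {δ : ℝ} {y : ℕ → 𝒴} {b a : 𝒴} {n : ℕ} (hL : 0 ≤ logFactor 𝒴 δ n)
    (h : Overtakes δ y b a n) : ∃ s ∈ Finset.Icc 1 n, 6 * logFactor 𝒴 δ n ≤
      √(12 * logFactor 𝒴 δ n / s) * ((sampleCount y n a : ℝ) - sampleCount y n b) -
        √(12 * logFactor 𝒴 δ n / s) ^ 2 / 2 *
          ((sampleCount y n a : ℝ) + sampleCount y n b) := by
  obtain ⟨hlt, hsq⟩ := h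
  have hne : a ≠ b := by rintro rfl; exact hlt.false
  refine ⟨sampleCount y n a + sampleCount y n b, Finset.mem_Icc.2 ⟨by omega, ?_⟩, ?_⟩
  · rw [← Finset.sum_pair (f := sampleCount y n) hne]
    exact (Finset.sum_le_sum_of_subset (Finset.subset_univ _)).trans (sum_sampleCount y n).le
  have hs : (0 : ℝ) < (sampleCount y n a + sampleCount y n b : ℕ) := by
    exact_mod_cast (by omega : 0 < sampleCount y n a + sampleCount y n b)
  have hD : (0 : ℝ) < (sampleCount y n a : ℝ) - sampleCount y n b := by
    rw [sub_pos]; exact_mod_cast hlt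
  rw [← Nat.cast_add] at hsq ⊢
  set s := sampleCount y n a + sampleCount y n b
  set D := (sampleCount y n a : ℝ) - sampleCount y n b
  set M := logFactor 𝒴 δ n
  have hl2 : √(12 * M / s) ^ 2 = 12 * M / s := Real.sq_sqrt (by positivity)
  have hl2' : √(12 * M / s) ^ 2 * s = 12 * M := by rw [hl2]; field_simp
  have hlD : 12 * M ≤ √(12 * M / s) * D := by
    refine (pow_le_pow_iff_left₀ (by positivity) (by positivity) two_ne_zero).1 ?_
    rw [mul_pow (√(12 * M / s)), hl2, div_mul_eq_mul_div, le_div_iff₀ hs]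
    nlinarith [mul_le_mul_of_nonneg_left hsq.le hL]
  nlinarith

lemma measureReal_overtakes_le [IsProbabilityMeasure P] (hY : ∀ r, Measurable (Y r))
    (hindep : iIndepFun Y P) (hp : ∀ r i, P.real {ω | Y r ω = i} = p i)
    (hp0 : ∀ i, 0 ≤ p i) (hp1 : ∑ i, p i = 1) (h𝒴 : 1 ≤ Fintype.card 𝒴) {δ : ℝ} (hδ : 0 < δ)
    (hδ1 : δ ≤ 1) {a b : 𝒴} (hab : p a ≤ p b) {n : ℕ} (hn : 1 ≤ n) :
    P.real {ω | Overtakes δ (fun k => Y k ω) b a n} ≤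
      δ / (Real.pi ^ 2 * Fintype.card 𝒴 * (n : ℝ) ^ 2) := by
  have hbase : 0 < Real.pi ^ 2 * Fintype.card 𝒴 * (n : ℝ) ^ 2 := by
    have : (0 : ℝ) < Fintype.card 𝒴 := by exact_mod_cast h𝒴
    positivity
  by_cases hne : a = b
  · subst hne
    simp only [Overtakes, lt_self_iff_false, false_and, Set.ofPred_false, measureReal_empty]
    positivity
  have hL := logFactor_nonneg h𝒴 hδ hδ1 hn
  set x := δ / (Real.pi ^ 2 * Fintype.card 𝒴 * (n : ℝ) ^ 2) with hx
  have hx0 : 0 < x := by positivity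
  have hexp : Real.exp (-logFactor 𝒴 δ n) = x := by
    rw [logFactor, Real.exp_neg, Real.exp_log (by positivity), inv_div]
  have hn' : (1 : ℝ) ≤ n := by exact_mod_cast hn
  have hnx : n ^ 2 * x ≤ 1 := by
    have := sq_le_pi_sq_mul_div h𝒴 hδ hδ1 n
    rw [le_div_iff₀ hδ] at this
    rw [hx, mul_div_assoc', div_le_one hbase]
    exact this
  have hsub : {ω | Overtakes δ (fun k => Y k ω) b a n} ⊆ ⋃ s ∈ Finset.Icc 1 n,
      {ω | 6 * logFactor 𝒴 δ n ≤ ∑ k ∈ Finset.range n,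
        (fun i => √(12 * logFactor 𝒴 δ n / s) *
            ((if i = a then 1 else 0) - (if i = b then 1 else 0)) -
          √(12 * logFactor 𝒴 δ n / s) ^ 2 / 2 *
            ((if i = a then 1 else 0) + (if i = b then 1 else 0))) (Y k ω)} := by
    intro ω hω
    obtain ⟨s, hs, h⟩ := Overtakes.exists_le hL hω
    simp only [Set.mem_iUnion]
    refine ⟨s, hs, ?_⟩
    rw [← sum_indicator_combination] at h
    exact h
  calc P.real {ω | Overtakes δ (fun k => Y k ω) b a n}
      ≤ ∑ s ∈ Finset.Icc 1 n, Real.exp (-(6 * logFactor 𝒴 δ n)) :=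
        (measureReal_mono hsub (measure_ne_top _ _)).trans <|
          (measureReal_biUnion_finset_le _ _).trans <| Finset.sum_le_sum fun s _ =>
            measureReal_le_exp_neg hY hindep hp
              (sum_mul_exp_combination_le_one hp0 hp1 hne hab (Real.sqrt_nonneg _)) n _
    _ = n * x ^ 6 := by
        rw [Finset.sum_const, Nat.card_Icc, Nat.add_sub_cancel, nsmul_eq_mul, ← hexp,
          ← Real.exp_nat_mul]
        push_cast
        ring_nf
    _ ≤ x := by
        -- The factor 6 in the exponent leaves ample room: `n² x ≤ 1` absorbs the `n` terms of the
        -- union.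
        have h1 : n * x ≤ 1 := by nlinarith
        have h2 : x ≤ 1 := by nlinarith
        have h3 : x ^ 5 ≤ x := by
          simpa using pow_le_pow_of_le_one hx0.le h2 (by norm_num : 1 ≤ 5)
        have h4 : n * x ^ 5 ≤ 1 := by nlinarith
        calc n * x ^ 6 = (n * x ^ 5) * x := by ring
          _ ≤ 1 * x := by gcongr
          _ = x := one_mul x

lemma measure_exists_overtakes_le [IsProbabilityMeasure P] (hY : ∀ r, Measurable (Y r))
    (hindep : iIndepFun Y P) (hp : ∀ r i, P.real {ω | Y r ω = i} = p i)
    (hp0 : ∀ i, 0 ≤ p i) (hp1 : ∑ i, p i = 1) (h𝒴 : 1 ≤ Fintype.card 𝒴) {δ : ℝ} (hδ : 0 < δ)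
    (hδ1 : δ ≤ 1) {b : 𝒴} (hmax : ∀ a, p a ≤ p b) :
    P {ω | ∃ n a, Overtakes δ (fun k => Y k ω) b a (n + 1)} ≤ ENNReal.ofReal δ := by
  have hm : (0 : ℝ) < Fintype.card 𝒴 := by exact_mod_cast h𝒴
  have hz : HasSum (fun n : ℕ => δ / Real.pi ^ 2 * (1 / ((n + 1 : ℕ) : ℝ) ^ 2))
      (δ / Real.pi ^ 2 * (Real.pi ^ 2 / 6)) := by
    refine HasSum.mul_left _ ?_
    have := (hasSum_nat_add_iff' 1).2 hasSum_zeta_two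
    simpa using this
  have hset : {ω | ∃ n a, Overtakes δ (fun k => Y k ω) b a (n + 1)} =
      ⋃ n, ⋃ a, {ω | Overtakes δ (fun k => Y k ω) b a (n + 1)} := by
    ext ω; simp
  rw [hset]
  calc P (⋃ n, ⋃ a, {ω | Overtakes δ (fun k => Y k ω) b a (n + 1)})
      ≤ ∑' n : ℕ, ∑ a, P {ω | Overtakes δ (fun k => Y k ω) b a (n + 1)} :=
        (measure_iUnion_le _).trans (ENNReal.tsum_le_tsum fun n => measure_iUnion_fintype_le _ _)
    _ ≤ ∑' n : ℕ, ENNReal.ofReal (δ / Real.pi ^ 2 * (1 / ((n + 1 : ℕ) : ℝ) ^ 2)) := by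
        refine ENNReal.tsum_le_tsum fun n => ?_
        calc ∑ a, P {ω | Overtakes δ (fun k => Y k ω) b a (n + 1)}
            ≤ ∑ a : 𝒴, ENNReal.ofReal
                (δ / (Real.pi ^ 2 * Fintype.card 𝒴 * ((n + 1 : ℕ) : ℝ) ^ 2)) := by
              refine Finset.sum_le_sum fun a _ => ?_
              rw [← ofReal_measureReal (measure_ne_top _ _)]
              exact ENNReal.ofReal_le_ofReal
                (measureReal_overtakes_le hY hindep hp hp0 hp1 h𝒴 hδ hδ1 (hmax a) (by omega))
          _ = _ := by
              rw [Finset.sum_const, Finset.card_univ, ← ENNReal.ofReal_nsmul, nsmul_eq_mul]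
              congr 1
              field_simp
    _ = ENNReal.ofReal (δ / Real.pi ^ 2 * (Real.pi ^ 2 / 6)) := by
        rw [← hz.tsum_eq, ENNReal.ofReal_tsum_of_nonneg (fun n => by positivity) hz.summable]
    _ ≤ ENNReal.ofReal δ := by
        refine ENNReal.ofReal_le_ofReal ?_
        have := Real.pi_pos
        field_simp
        linarith

/-! ### Deviations of the empirical frequencies -/

lemma measureReal_lt_abs_sub_le [IsProbabilityMeasure P] (hY : ∀ r, Measurable (Y r))
    (hindep : iIndepFun Y P) (hp : ∀ r i, P.real {ω | Y r ω = i} = p i) {η : ℝ} (hη : 0 ≤ η)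
    (n : ℕ) (j : 𝒴) :
    P.real {ω | n * η < |(sampleCount (fun k => Y k ω) n j : ℝ) - n * p j|} ≤
      2 * Real.exp (-2 * η ^ 2) ^ n := by
  set f : 𝒴 → ℝ := fun i => if i = j then 1 else 0 with hf
  have hfm : Measurable f := Measurable.of_discrete
  have hmean : ∀ k, ∫ ω, f (Y k ω) ∂P = p j := fun k => by
    rw [integral_comp_sample hY hp]; simp [hf]
  have hsub : ∀ k, HasSubgaussianMGF (fun ω => f (Y k ω) - p j) ((‖(1 : ℝ) - 0‖₊ / 2) ^ 2) P := by
    intro k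
    have := hasSubgaussianMGF_of_mem_Icc (μ := P) (X := fun ω => f (Y k ω)) (a := 0) (b := 1)
      (hfm.comp (hY k)).aemeasurable
      (ae_of_all _ fun ω => by simp only [hf]; split_ifs <;> simp)
    rwa [hmean k] at this
  have hi : iIndepFun (fun k ω => f (Y k ω) - p j) P :=
    hindep.comp (fun _ i => f i - p j) fun _ => Measurable.of_discrete
  have hi' : iIndepFun (fun k ω => -(f (Y k ω) - p j)) P :=
    hindep.comp (fun _ i => -(f i - p j)) fun _ => Measurable.of_discrete
  have hnη : 0 ≤ n * η := by positivity
  have h1 := HasSubgaussianMGF.measure_sum_range_ge_le_of_iIndepFun hi (n := n) (fun k _ => hsub k) hnη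
  have h2 := HasSubgaussianMGF.measure_sum_range_ge_le_of_iIndepFun hi' (n := n) (fun k _ => (hsub k).neg) hnη
  have hexp : Real.exp (-(n * η) ^ 2 / (2 * n * (((‖(1 : ℝ) - 0‖₊ / 2) ^ 2 : NNReal) : ℝ))) =
      Real.exp (-2 * η ^ 2) ^ n := by
    rw [← Real.exp_nat_mul]
    congr 1
    rcases Nat.eq_zero_or_pos n with rfl | hn
    · simp
    · have : (0 : ℝ) < n := by exact_mod_cast hn
      simp
      field_simp
  rw [hexp] at h1 h2
  have hsum : ∀ ω, ∑ k ∈ Finset.range n, (f (Y k ω) - p j) =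
      (sampleCount (fun k => Y k ω) n j : ℝ) - n * p j := fun ω => by
    simp [sampleCount, hf, Finset.sum_sub_distrib]
  have hincl : {ω | n * η < |(sampleCount (fun k => Y k ω) n j : ℝ) - n * p j|} ⊆
      {ω | n * η ≤ ∑ k ∈ Finset.range n, (f (Y k ω) - p j)} ∪
        {ω | n * η ≤ ∑ k ∈ Finset.range n, -(f (Y k ω) - p j)} := by
    intro ω hω
    have hω' : n * η < |(sampleCount (fun k => Y k ω) n j : ℝ) - n * p j| := hω
    simp only [Set.mem_union, Set.mem_ofPred_eq, Finset.sum_neg_distrib, hsum]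
    rcases lt_abs.1 hω' with h | h
    · exact Or.inl h.le
    · exact Or.inr h.le
  calc _ ≤ _ := measureReal_mono hincl (measure_ne_top _ _)
    _ ≤ _ := measureReal_union_le _ _
    _ ≤ _ := by linarith

lemma measure_deviates_le [IsProbabilityMeasure P] (hY : ∀ r, Measurable (Y r))
    (hindep : iIndepFun Y P) (hp : ∀ r i, P.real {ω | Y r ω = i} = p i) {η : ℝ} (hη : 0 ≤ η)
    (h𝒴 : 1 ≤ Fintype.card 𝒴) (n : ℕ) :
    P {ω | Deviates p η (fun k => Y k ω) n} ≤
      ENNReal.ofReal (Fintype.card 𝒴 * (2 * Real.exp (-2 * η ^ 2) ^ n)) := by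
  have hm : (1 : ℝ) ≤ Fintype.card 𝒴 := by exact_mod_cast h𝒴
  rcases Nat.eq_zero_or_pos n with rfl | hn
  -- Time 0 counts as a deviation, and the bound there is `2 m ≥ 1`.
  · refine prob_le_one.trans ?_
    rw [ENNReal.one_le_ofReal]
    simp only [pow_zero]
    linarith
  have hset : {ω | Deviates p η (fun k => Y k ω) n} =
      ⋃ j, {ω | n * η < |(sampleCount (fun k => Y k ω) n j : ℝ) - n * p j|} := by
    ext ω
    simp [Deviates, hn.ne']
  rw [hset]
  refine (measure_iUnion_fintype_le _ _).trans ?_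
  calc _ ≤ ∑ j : 𝒴, ENNReal.ofReal (2 * Real.exp (-2 * η ^ 2) ^ n) := by
        refine Finset.sum_le_sum fun j _ => ?_
        rw [← ofReal_measureReal (measure_ne_top _ _)]
        exact ENNReal.ofReal_le_ofReal (measureReal_lt_abs_sub_le hY hindep hp hη n j)
    _ = _ := by
        rw [Finset.sum_const, Finset.card_univ, ← ENNReal.ofReal_nsmul, nsmul_eq_mul]

/-- A bound for the expected number of rounds preceded by a late deviation. -/
noncomputable def deviationBound (m : ℕ) (η : ℝ) : ℝ :=
  ∑' k : ℕ, (2 * k + 2 : ℕ) * (m * (2 * Real.exp (-2 * η ^ 2) ^ k))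

lemma deviationBound_nonneg (m : ℕ) (η : ℝ) : 0 ≤ deviationBound m η :=
  tsum_nonneg fun k => by positivity

lemma summable_deviationBound (m : ℕ) {η : ℝ} (hη : 0 < η) :
    Summable fun k : ℕ => ((2 * k + 2 : ℕ) : ℝ) * (m * (2 * Real.exp (-2 * η ^ 2) ^ k)) := by
  have hq : ‖Real.exp (-2 * η ^ 2)‖ < 1 := by
    rw [Real.norm_eq_abs, Real.abs_exp, Real.exp_lt_one_iff]
    have : 0 < η ^ 2 := by positivity
    linarith
  have h1 := (summable_pow_mul_geometric_of_norm_lt_one 1 hq).mul_left (4 * m : ℝ)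
  have h0 := (summable_geometric_of_norm_lt_one hq).mul_left (4 * m : ℝ)
  refine (h1.add h0).congr fun k => ?_
  push_cast
  ring

/-- A deviation at time `k` spoils only the `2k + 2` rounds `r ≤ 2k + 1`. Exchanging the sums leaves
a linear factor times a geometric term. -/
lemma tsum_measure_deviatesAfterHalf_le [IsProbabilityMeasure P] (hY : ∀ r, Measurable (Y r))
    (hindep : iIndepFun Y P) (hp : ∀ r i, P.real {ω | Y r ω = i} = p i) {η : ℝ} (hη : 0 < η)
    (h𝒴 : 1 ≤ Fintype.card 𝒴) :
    ∑' r, P {ω | DeviatesAfterHalf p η (fun k => Y k ω) r} ≤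
      ENNReal.ofReal (deviationBound (Fintype.card 𝒴) η) := by
  calc ∑' r, P {ω | DeviatesAfterHalf p η (fun k => Y k ω) r}
      ≤ ∑' r, ∑' k, if r ≤ 2 * k + 1 then P {ω | Deviates p η (fun k => Y k ω) k} else 0 := by
        refine ENNReal.tsum_le_tsum fun r => ?_
        have hsub : {ω | DeviatesAfterHalf p η (fun k => Y k ω) r} ⊆
            ⋃ k, {ω | r ≤ 2 * k + 1 ∧ Deviates p η (fun k => Y k ω) k} := by
          rintro ω ⟨k, hk⟩
          exact Set.mem_iUnion.2 ⟨k, hk⟩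
        refine (measure_mono hsub).trans ((measure_iUnion_le _).trans ?_)
        refine ENNReal.tsum_le_tsum fun k => ?_
        split_ifs with hk <;> simp [hk]
    _ = ∑' k : ℕ, (2 * k + 2 : ℕ) * P {ω | Deviates p η (fun k => Y k ω) k} := by
        rw [ENNReal.tsum_comm]
        refine tsum_congr fun k => ?_
        rw [tsum_eq_sum (s := Finset.range (2 * k + 2))
          (fun r hr => if_neg fun h => hr (Finset.mem_range.2 (by omega)))]
        rw [Finset.sum_congr rfl fun r hr =>
          if_pos (by have := Finset.mem_range.1 hr; omega : r ≤ 2 * k + 1)]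
        rw [Finset.sum_const, Finset.card_range, nsmul_eq_mul]
    _ ≤ ∑' k : ℕ, ENNReal.ofReal
          ((2 * k + 2 : ℕ) * (Fintype.card 𝒴 * (2 * Real.exp (-2 * η ^ 2) ^ k))) := by
        refine ENNReal.tsum_le_tsum fun k => ?_
        rw [ENNReal.ofReal_mul (Nat.cast_nonneg _), ENNReal.ofReal_natCast]
        gcongr
        exact measure_deviates_le hY hindep hp hη.le h𝒴 k
    _ = _ := by
        rw [deviationBound, ENNReal.ofReal_tsum_of_nonneg (fun k => by positivity)
          (summable_deviationBound _ hη)]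

end Samples

end Elimination

namespace Elimination

/-! ### Success and expected number of queries -/

section Bounds

variable {𝒴 : Type*} [Fintype 𝒴] [DecidableEq 𝒴] {δ : ℝ} {p : 𝒴 → ℝ} {η : ℝ} {b : 𝒴} {t : 𝒴 → ℕ}

/-- The gap `η` and the times `t` are such that, as long as the empirical frequencies stay within
`η` of `p`, each class `a` other than the most likely class `b` is eliminated shortly after
time `t a`. -/
structure IsEliminationTime (δ : ℝ) (p : 𝒴 → ℝ) (η : ℝ) (b : 𝒴) (t : 𝒴 → ℕ) : Prop where
  nonneg : ∀ a, 0 ≤ p a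
  sum_eq_one : ∑ a, p a = 1
  pos : 0 < p b
  lt_of_ne : ∀ a ≠ b, p a < p b
  gap_pos : 0 < η
  four_mul_gap_le : 4 * η ≤ p b
  four_mul_gap_le_sub : ∀ a ≠ b, 4 * η ≤ p b - p a
  eq_zero_or_two_mul_gap_le : ∀ a, p a = 0 ∨ 2 * η ≤ p a
  lt_of_le : ∀ a ≠ b, ∀ n : ℕ, t a ≤ n → 192 * p b * logFactor 𝒴 δ n < n * (p b - p a) ^ 2
  le_time : ∀ a, t a ≤ t b

lemma IsEliminationTime.le_max (h : IsEliminationTime δ p η b t) (a : 𝒴) : p a ≤ p b := by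
  by_cases ha : a = b
  · rw [ha]
  · exact (h.lt_of_ne a ha).le

lemma IsEliminationTime.returns (h : IsEliminationTime δ p η b t) (h𝒴 : 1 ≤ Fintype.card 𝒴)
    (hδ : 0 < δ) (hδ1 : δ ≤ 1) {y : ℕ → 𝒴} (hy : ∀ n a, ¬ Overtakes δ y b a (n + 1)) {r : ℕ}
    (hr : 2 * t b ≤ r) (hdev : ¬ DeviatesAfterHalf p η y r) :
    Returns (schedule 𝒴 δ) y b := by
  have hb := notMem_eliminated_of_not_overtakes h𝒴 hδ hδ1 hy
  refine ⟨r, active_eq_of_finished (hb r) (finished_of_forall_mem_eliminated (hb r) fun a hab =>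
    finished_or_mem_eliminated h𝒴 hδ hδ1 h.pos h.le_max h.four_mul_gap_le
      (h.four_mul_gap_le_sub a hab) hb hdev (fun n hn => h.lt_of_le a hab n ?_)
      (h.lt_of_ne a hab))⟩
  have := h.le_time a
  omega

lemma IsEliminationTime.roundQueries_le (h : IsEliminationTime δ p η b t)
    (h𝒴 : 1 ≤ Fintype.card 𝒴) (hδ : 0 < δ) (hδ1 : δ ≤ 1) {τ : TreeRule 𝒴}
    (hτ : IsHuffmanRule (schedule 𝒴 δ) τ) {y : ℕ → 𝒴} (hy : Returns (schedule 𝒴 δ) y b) {r : ℕ}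
    (hdev : ¬ DeviatesAfterHalf p η y r) :
    roundQueries (schedule 𝒴 δ) τ y r ≤
      (if r < 2 * t b then 1 else 0) + if r < 2 * t (y r) then identifyBound p (y r) else 0 :=
  hτ.roundQueries_le h𝒴 hδ hδ1 h.nonneg h.lt_of_ne h.four_mul_gap_le h.four_mul_gap_le_sub
    h.eq_zero_or_two_mul_gap_le hy.notMem_eliminated hdev h.pos h.lt_of_le h.le_time

variable [MeasurableSpace 𝒴] [MeasurableSingletonClass 𝒴]
  {Ω : Type*} [MeasurableSpace Ω] {P : Measure Ω} {Y : ℕ → Ω → 𝒴}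

lemma measurableSet_returns (hY : ∀ r, Measurable (Y r)) (σ : Schedule 𝒴) (b : 𝒴) :
    MeasurableSet {ω | Returns σ (fun r => Y r ω) b} := by
  have : {ω | Returns σ (fun r => Y r ω) b} =
      ⋃ r, {ω | (run σ (fun r => Y r ω) r).active = {b}} := by
    ext ω; simp [Returns]
  rw [this]
  refine MeasurableSet.iUnion fun r =>
    measurableSet_of_forall_lt hY (Q := fun y => (run σ y r).active = {b}) (r := r) ?_
  intro y y' hyy h
  rwa [← run_congr hyy]

lemma measurableSet_deviatesAfterHalf (hY : ∀ r, Measurable (Y r)) (r : ℕ) :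
    MeasurableSet {ω | DeviatesAfterHalf p η (fun k => Y k ω) r} := by
  have : {ω | DeviatesAfterHalf p η (fun k => Y k ω) r} =
      ⋃ k, {ω | r ≤ 2 * k + 1 ∧ Deviates p η (fun k => Y k ω) k} := by
    ext ω; simp [DeviatesAfterHalf]
  rw [this]
  refine MeasurableSet.iUnion fun k => measurableSet_of_forall_lt hY
    (Q := fun y => r ≤ 2 * k + 1 ∧ Deviates p η y k) (r := k) ?_
  intro y y' hyy h
  have hc : sampleCount y' k = sampleCount y k := by
    funext a
    exact Finset.sum_congr rfl fun i hi => by rw [hyy i (Finset.mem_range.1 hi)]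
  rwa [Deviates, hc]

/-- Failure requires that `b` is overtaken or that late deviations occur for all large `r`. The
latter has probability zero because their probabilities are summable. -/
lemma IsEliminationTime.one_sub_le_measureReal_returns [IsProbabilityMeasure P]
    (h : IsEliminationTime δ p η b t) (h𝒴 : 1 ≤ Fintype.card 𝒴) (hδ : 0 < δ) (hδ1 : δ ≤ 1)
    (hY : ∀ r, Measurable (Y r)) (hindep : iIndepFun Y P)
    (hp : ∀ r i, P.real {ω | Y r ω = i} = p i) :
    1 - δ ≤ P.real {ω | Returns (schedule 𝒴 δ) (fun r => Y r ω) b} := by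
  set B := {ω | Returns (schedule 𝒴 δ) (fun r => Y r ω) b}
  set D := {ω | ∀ r, 2 * t b ≤ r → DeviatesAfterHalf p η (fun k => Y k ω) r}
  have hD : P D = 0 := by
    have hlim := ENNReal.tendsto_atTop_zero_of_tsum_ne_top (ne_top_of_le_ne_top ENNReal.ofReal_ne_top
      (tsum_measure_deviatesAfterHalf_le hY hindep hp h.gap_pos h𝒴))
    refine le_antisymm (ge_of_tendsto hlim ?_) zero_le
    filter_upwards [eventually_ge_atTop (2 * t b)] with r hr
    exact measure_mono fun ω hω => hω r hr
  have hsub : Bᶜ ⊆ {ω | ∃ n a, Overtakes δ (fun k => Y k ω) b a (n + 1)} ∪ D := by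
    intro ω hω
    by_contra hn
    simp only [Set.mem_union, not_or] at hn
    obtain ⟨h1, h2⟩ := hn
    have h1' : ∀ n a, ¬ Overtakes δ (fun k => Y k ω) b a (n + 1) := fun n a ho => h1 ⟨n, a, ho⟩
    have h2' : ∃ r, 2 * t b ≤ r ∧ ¬ DeviatesAfterHalf p η (fun k => Y k ω) r := by
      by_contra! hall
      exact h2 hall
    obtain ⟨r, hr, hdev⟩ := h2'
    exact hω (h.returns h𝒴 hδ hδ1 h1' hr hdev)
  have hfail : P Bᶜ ≤ ENNReal.ofReal δ := by
    refine (measure_mono hsub).trans ((measure_union_le _ _).trans ?_)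
    rw [hD, add_zero]
    exact measure_exists_overtakes_le hY hindep hp h.nonneg h.sum_eq_one h𝒴 hδ hδ1 h.le_max
  have := ENNReal.toReal_le_of_le_ofReal hδ.le hfail
  rw [← measureReal_def, probReal_compl_eq_one_sub (measurableSet_returns hY _ _)] at this
  linarith

/-- The pointwise bound holds on success only, but its right side is nonnegative and may be
integrated over the whole space. There each sample has law `p`, and no conditioning disturbs it. -/
lemma IsEliminationTime.setLIntegral_totalQueries_le [IsProbabilityMeasure P]
    (h : IsEliminationTime δ p η b t) (h𝒴 : 1 ≤ Fintype.card 𝒴) (hδ : 0 < δ) (hδ1 : δ ≤ 1)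
    (hY : ∀ r, Measurable (Y r)) (hindep : iIndepFun Y P)
    (hp : ∀ r i, P.real {ω | Y r ω = i} = p i) {τ : TreeRule 𝒴}
    (hτ : IsHuffmanRule (schedule 𝒴 δ) τ) :
    ∫⁻ ω in {ω | Returns (schedule 𝒴 δ) (fun r => Y r ω) b},
        totalQueries (schedule 𝒴 δ) τ (fun r => Y r ω) ∂P ≤
      ENNReal.ofReal ((Fintype.card 𝒴 + 1) * deviationBound (Fintype.card 𝒴) η + 2 * t b +
        ∑ a, p a * (2 * t a * identifyBound p a)) := by
  classical
  set D : ℕ → Set Ω := fun r => {ω | DeviatesAfterHalf p η (fun k => Y k ω) r}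
  set c : ℕ → ℝ≥0∞ := fun r => if r < 2 * t b then 1 else 0 with hc
  set g : ℕ → 𝒴 → ℝ≥0∞ := fun r a => if r < 2 * t a then (identifyBound p a : ℝ≥0∞) else 0 with hg
  have hDm : ∀ r, MeasurableSet (D r) := fun r => measurableSet_deviatesAfterHalf hY r
  have hgm : ∀ r, Measurable fun ω => g r (Y r ω) := fun r =>
    (Measurable.of_discrete (f := g r)).comp (hY r)
  have hbound : ∀ ω ∈ {ω | Returns (schedule 𝒴 δ) (fun r => Y r ω) b},
      totalQueries (schedule 𝒴 δ) τ (fun r => Y r ω) ≤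
        ∑' r, ((Fintype.card 𝒴 + 1 : ℝ≥0∞) * (D r).indicator 1 ω + (c r + g r (Y r ω))) := by
    intro ω hω
    refine ENNReal.tsum_le_tsum fun r => ?_
    by_cases hdev : ω ∈ D r
    · rw [Set.indicator_of_mem hdev, Pi.one_apply, mul_one]
      refine le_trans ?_ le_self_add
      exact_mod_cast hτ.roundQueries_le_card (fun r => Y r ω) r
    · refine le_trans ?_ le_add_self
      have := h.roundQueries_le h𝒴 hδ hδ1 hτ hω hdev
      calc (roundQueries (schedule 𝒴 δ) τ (fun r => Y r ω) r : ℝ≥0∞)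
          ≤ (((if r < 2 * t b then 1 else 0) +
              if r < 2 * t (Y r ω) then identifyBound p (Y r ω) else 0 : ℕ) : ℝ≥0∞) := by
            exact_mod_cast this
        _ = c r + g r (Y r ω) := by simp [hc, hg]
  have hsum : ∀ (N : ℕ) (x : ℝ≥0∞), ∑' r, (if r < N then x else 0) = N * x := by
    intro N x
    rw [tsum_eq_sum (s := Finset.range N) fun r hr => if_neg (by simpa using hr),
      Finset.sum_congr rfl fun r hr => if_pos (Finset.mem_range.1 hr), Finset.sum_const,
      Finset.card_range, nsmul_eq_mul]
  calc _ ≤ ∫⁻ ω, ∑' r, ((Fintype.card 𝒴 + 1 : ℝ≥0∞) * (D r).indicator 1 ω +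
          (c r + g r (Y r ω))) ∂P :=
        (setLIntegral_mono' (measurableSet_returns hY _ _) hbound).trans
          (setLIntegral_le_lintegral _ _)
    _ = ∑' r, ((Fintype.card 𝒴 + 1 : ℝ≥0∞) * P (D r) +
          (c r + ∑ a, ENNReal.ofReal (p a) * g r a)) := by
        have hm : ∀ r, AEMeasurable (fun ω => (Fintype.card 𝒴 + 1 : ℝ≥0∞) * (D r).indicator 1 ω +
            (c r + g r (Y r ω))) P := fun r =>
          (((measurable_one.indicator (hDm r)).const_mul _).add
            ((hgm r).const_add _)).aemeasurable
        rw [lintegral_tsum hm]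
        refine tsum_congr fun r => ?_
        rw [lintegral_add_left ((measurable_one.indicator (hDm r)).const_mul _),
          lintegral_const_mul _ (measurable_one.indicator (hDm r)), lintegral_indicator_one (hDm r),
          lintegral_add_left measurable_const, lintegral_const, measure_univ, mul_one,
          lintegral_comp_sample hY hp]
    _ = (Fintype.card 𝒴 + 1 : ℝ≥0∞) * ∑' r, P (D r) +
          ((2 * t b : ℕ) + ∑ a, ENNReal.ofReal (p a) * ((2 * t a : ℕ) * identifyBound p a)) := by
        rw [ENNReal.tsum_add, ENNReal.tsum_add, ENNReal.tsum_mul_left, hsum, mul_one,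
          Summable.tsum_finsetSum fun _ _ => ENNReal.summable]
        simp_rw [ENNReal.tsum_mul_left, hg, hsum]
    _ ≤ ENNReal.ofReal (Fintype.card 𝒴 + 1) *
          ENNReal.ofReal (deviationBound (Fintype.card 𝒴) η) +
          (ENNReal.ofReal (2 * t b) +
            ∑ a, ENNReal.ofReal (p a * (2 * t a * identifyBound p a))) := by
        have e1 : ENNReal.ofReal (Fintype.card 𝒴 + 1) = (Fintype.card 𝒴 + 1 : ℝ≥0∞) := by
          rw [← Nat.cast_add_one, ENNReal.ofReal_natCast]; push_cast; rfl
        have e2 : ENNReal.ofReal (2 * t b) = ((2 * t b : ℕ) : ℝ≥0∞) := by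
          rw [← ENNReal.ofReal_natCast]; push_cast; rfl
        have e3 : ∀ a, ENNReal.ofReal (p a * (2 * t a * identifyBound p a)) =
            ENNReal.ofReal (p a) * ((2 * t a : ℕ) * identifyBound p a) := fun a => by
          rw [ENNReal.ofReal_mul (h.nonneg a), ← Nat.cast_mul, ← ENNReal.ofReal_natCast]
          push_cast
          rfl
        rw [e1, e2]
        simp_rw [e3]
        gcongr
        exact tsum_measure_deviatesAfterHalf_le hY hindep hp h.gap_pos h𝒴
    _ = _ := by
        have hnn : ∀ a ∈ Finset.univ, 0 ≤ p a * (2 * t a * identifyBound p a) := fun a _ =>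
          mul_nonneg (h.nonneg a) (by positivity)
        have hK := deviationBound_nonneg (Fintype.card 𝒴) η
        rw [← ENNReal.ofReal_mul (by positivity), ← ENNReal.ofReal_sum_of_nonneg hnn,
          ← ENNReal.ofReal_add (by positivity) (Finset.sum_nonneg hnn),
          ← ENNReal.ofReal_add (by positivity)
            (add_nonneg (by positivity) (Finset.sum_nonneg hnn)), add_assoc]

end Bounds

/-! ### Choice of the parameters -/

/-- Provides a threshold `n₀` independent of `δ` that absorbs the `log n` part of the schedule. -/
lemma exists_forall_add_log_lt (c₀ c₁ : ℝ) {c₂ : ℝ} (hc₂ : 0 < c₂) :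
    ∃ n₀ : ℕ, 1 ≤ n₀ ∧ ∀ n : ℕ, n₀ ≤ n → c₀ + c₁ * Real.log n < c₂ * n := by
  have h : (fun x : ℝ => c₀ + c₁ * Real.log x) =o[atTop] fun x => x :=
    (Asymptotics.isLittleO_const_id_atTop c₀).add (Real.isLittleO_log_id_atTop.const_mul_left c₁)
  have h' := (h.comp_tendsto tendsto_natCast_atTop_atTop).def (half_pos hc₂)
  obtain ⟨n₀, hn₀⟩ := eventually_atTop.1 h'
  refine ⟨max n₀ 1, le_max_right _ _, fun n hn => ?_⟩
  have h1 := hn₀ n ((le_max_left _ _).trans hn)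
  have h2 : (1 : ℝ) ≤ n := by exact_mod_cast (le_max_right _ _).trans hn
  simp only [Function.comp_apply, Real.norm_eq_abs, Nat.abs_cast] at h1
  nlinarith [le_abs_self (c₀ + c₁ * Real.log n)]

lemma exists_gap {𝒴 : Type*} [Fintype 𝒴] {p : 𝒴 → ℝ} {b : 𝒴} (hp0 : ∀ a, 0 ≤ p a)
    (hpb : 0 < p b) (hlt : ∀ a ≠ b, p a < p b) :
    ∃ η : ℝ, 0 < η ∧ 4 * η ≤ p b ∧ (∀ a ≠ b, 4 * η ≤ p b - p a) ∧
      ∀ a, p a = 0 ∨ 2 * η ≤ p a := by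
  have key : ∀ c x : ℝ, 0 < x → ∀ᶠ η in 𝓝[>] (0 : ℝ), c * η ≤ x := fun c x hx => by
    have : Tendsto (fun η : ℝ => c * η) (𝓝[>] 0) (𝓝 0) := by
      have := (continuous_const_mul c).tendsto (0 : ℝ)
      rw [mul_zero] at this
      exact this.mono_left nhdsWithin_le_nhds
    exact this.eventually_le_const hx
  have h1 := key 4 (p b) hpb
  have h2 : ∀ᶠ η in 𝓝[>] (0 : ℝ), ∀ a, a ≠ b → 4 * η ≤ p b - p a :=
    eventually_all.2 fun a => by
      by_cases ha : a = b
      · simp [ha]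
      · filter_upwards [key 4 _ (sub_pos.2 (hlt a ha))] with η hη _ using hη
  have h3 : ∀ᶠ η in 𝓝[>] (0 : ℝ), ∀ a, p a = 0 ∨ 2 * η ≤ p a :=
    eventually_all.2 fun a => by
      by_cases ha : p a = 0
      · simp [ha]
      · filter_upwards [key 2 _ (lt_of_le_of_ne (hp0 a) (Ne.symm ha))] with η hη using Or.inr hη
  obtain ⟨η, ⟨⟨h1, h2⟩, h3⟩, hη⟩ := (((h1.and h2).and h3).and self_mem_nhdsWithin).exists
  exact ⟨η, hη, h1, h2, h3⟩

lemma logFactor_eq {𝒴 : Type*} [Fintype 𝒴] (h𝒴 : 1 ≤ Fintype.card 𝒴) {δ : ℝ} (hδ : 0 < δ) {n : ℕ}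
    (hn : 1 ≤ n) : logFactor 𝒴 δ n =
      Real.log (Real.pi ^ 2 * Fintype.card 𝒴) + 2 * Real.log n + Real.log (1 / δ) := by
  have hm : (0 : ℝ) < Fintype.card 𝒴 := by exact_mod_cast h𝒴
  have hn' : (0 : ℝ) < n := by exact_mod_cast hn
  rw [logFactor, div_eq_mul_one_div, Real.log_mul (by positivity) (by positivity),
    Real.log_mul (by positivity) (by positivity), Real.log_pow]
  push_cast
  rfl

lemma tendsto_error (X K : ℝ) :
    Tendsto (fun δ : ℝ => (X * Real.log (1 / δ) + K) / (Real.log (1 / δ) * (1 - δ)) - X)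
      (𝓝[>] 0) (𝓝 0) := by
  have hlog : Tendsto (fun δ : ℝ => Real.log (1 / δ)) (𝓝[>] 0) atTop := by
    simp only [one_div]
    exact Real.tendsto_log_atTop.comp tendsto_inv_nhdsGT_zero
  have h1 : Tendsto (fun δ : ℝ => (1 - δ)⁻¹) (𝓝[>] 0) (𝓝 1) := by
    have : Tendsto (fun δ : ℝ => (1 - δ)⁻¹) (𝓝 0) (𝓝 (1 - 0)⁻¹) :=
      (tendsto_const_nhds.sub tendsto_id).inv₀ (by norm_num)
    rw [sub_zero, inv_one] at this
    exact this.mono_left nhdsWithin_le_nhds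
  have h2 : Tendsto (fun δ : ℝ => K * (Real.log (1 / δ))⁻¹) (𝓝[>] 0) (𝓝 (K * 0)) :=
    (tendsto_inv_atTop_zero.comp hlog).const_mul K
  have h3 := (((h2.const_add X).mul h1).sub_const X)
  rw [mul_zero, add_zero, mul_one, sub_self] at h3
  refine h3.congr' ?_
  filter_upwards [hlog.eventually_gt_atTop 0] with δ hδ
  have : (X * Real.log (1 / δ) + K) / (Real.log (1 / δ) * (1 - δ)) =
      (X + K * (Real.log (1 / δ))⁻¹) * (1 - δ)⁻¹ := by
    rw [← div_div, add_div, mul_div_cancel_right₀ _ hδ.ne', div_eq_mul_inv, div_eq_mul_inv]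
  rw [this]

end Elimination

/-! ### Ordering of the gaps -/

lemma modeGap_of_ne {m : ℕ} (hm : 2 ≤ m) (p : Fin m → ℝ) {i : Fin m}
    (hi : i ≠ ⟨0, by omega⟩) : modeGap hm p i = p ⟨0, by omega⟩ - p i := if_neg hi

lemma modeGap_zero {m : ℕ} (hm : 2 ≤ m) (p : Fin m → ℝ) :
    modeGap hm p ⟨0, by omega⟩ = modeGap hm p ⟨1, by omega⟩ := by
  rw [modeGap_of_ne hm p (i := ⟨1, by omega⟩) (by simp [Fin.ext_iff])]
  exact if_pos rfl

lemma modeGap_one_pos {m : ℕ} (hm : 2 ≤ m) {p : Fin m → ℝ}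
    (hlt : ∀ i : Fin m, i ≠ ⟨0, by omega⟩ → p i < p ⟨0, by omega⟩) :
    0 < modeGap hm p ⟨1, by omega⟩ := by
  rw [modeGap_of_ne hm p (by simp [Fin.ext_iff])]
  exact sub_pos.2 (hlt _ (by simp [Fin.ext_iff]))

lemma modeGap_one_le {m : ℕ} (hm : 2 ≤ m) {p : Fin m → ℝ} (hanti : Antitone p) (i : Fin m) :
    modeGap hm p ⟨1, by omega⟩ ≤ modeGap hm p i := by
  by_cases hi : i = ⟨0, by omega⟩
  · rw [hi, modeGap_zero]
  · rw [modeGap_of_ne hm p hi, modeGap_of_ne hm p (by simp [Fin.ext_iff])]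
    have : (⟨1, by omega⟩ : Fin m) ≤ i := by
      rw [Fin.le_def]
      have : (i : ℕ) ≠ 0 := fun h => hi (Fin.ext h)
      show 1 ≤ (i : ℕ)
      omega
    linarith [hanti this]

/-! ### Explicit elimination times and the constants -/

namespace Elimination

/-- The order of the number of samples needed to eliminate a class, up to the logarithmic factor. -/
noncomputable def eliminationRate {m : ℕ} (hm : 2 ≤ m) (p : Fin m → ℝ) (i : Fin m) : ℝ :=
  p ⟨0, by omega⟩ / modeGap hm p i ^ 2

/-- The time after which the class `i` is eliminated in a typical run. -/
noncomputable def eliminationTime {m : ℕ} (hm : 2 ≤ m) (p : Fin m → ℝ) (n₀ : ℕ) (δ : ℝ)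
    (i : Fin m) : ℕ :=
  ⌈384 * eliminationRate hm p i * Real.log (1 / δ)⌉₊ + n₀

section

variable {m : ℕ} {p : Fin m → ℝ}

lemma eliminationRate_nonneg (hm : 2 ≤ m) (hp0 : ∀ i, 0 ≤ p i) (i : Fin m) :
    0 ≤ eliminationRate hm p i := div_nonneg (hp0 _) (sq_nonneg _)

lemma eliminationRate_le (hm : 2 ≤ m) (hp0 : ∀ i, 0 ≤ p i) (hanti : Antitone p)
    (hlt : ∀ i : Fin m, i ≠ ⟨0, by omega⟩ → p i < p ⟨0, by omega⟩) (i : Fin m) :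
    eliminationRate hm p i ≤ eliminationRate hm p ⟨1, by omega⟩ := by
  have h1 := modeGap_one_pos hm hlt
  have h2 := modeGap_one_le hm hanti i
  have h3 := hp0 ⟨0, by omega⟩
  unfold eliminationRate
  gcongr

/-- The requirement `192 p(b) L < n · gap²` is split in halves: the ceiling in `eliminationTime`
pays for `log (1 / δ)`, hence `384 = 2 · 192`, and `n₀` pays for the rest with the smallest gap. -/
lemma isEliminationTime (hm : 2 ≤ m) (hp0 : ∀ i, 0 ≤ p i) (hp1 : ∑ i, p i = 1)
    (hanti : Antitone p) (hlt : ∀ i : Fin m, i ≠ ⟨0, by omega⟩ → p i < p ⟨0, by omega⟩)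
    {η : ℝ} (hη : 0 < η) (hη1 : 4 * η ≤ p ⟨0, by omega⟩)
    (hη2 : ∀ a : Fin m, a ≠ ⟨0, by omega⟩ → 4 * η ≤ p ⟨0, by omega⟩ - p a)
    (hη3 : ∀ a, p a = 0 ∨ 2 * η ≤ p a) {n₀ : ℕ} (hn₀ : 1 ≤ n₀)
    (hlog : ∀ n : ℕ, n₀ ≤ n →
      192 * p ⟨0, by omega⟩ * Real.log (Real.pi ^ 2 * m) +
        384 * p ⟨0, by omega⟩ * Real.log n < modeGap hm p ⟨1, by omega⟩ ^ 2 / 2 * n)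
    {δ : ℝ} (hδ : 0 < δ) (hδ1 : δ ≤ 1) :
    IsEliminationTime δ p η ⟨0, by omega⟩ (eliminationTime hm p n₀ δ) where
  nonneg := hp0
  sum_eq_one := hp1
  pos := by linarith
  lt_of_ne := hlt
  gap_pos := hη
  four_mul_gap_le := hη1
  four_mul_gap_le_sub := hη2
  eq_zero_or_two_mul_gap_le := hη3
  le_time a := by
    have hL : 0 ≤ Real.log (1 / δ) := Real.log_nonneg (by rwa [le_div_iff₀ hδ, one_mul])
    refine Nat.add_le_add_right (Nat.ceil_le_ceil ?_) _
    have := eliminationRate_le hm hp0 hanti hlt a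
    rw [show eliminationRate hm p ⟨0, by omega⟩ = eliminationRate hm p ⟨1, by omega⟩ by
      rw [eliminationRate, modeGap_zero, eliminationRate]]
    gcongr
  lt_of_le a ha n hn := by
    have hn0 : n₀ ≤ n := le_trans (Nat.le_add_left _ _) hn
    have hgap := modeGap_one_pos hm hlt
    have hle := modeGap_one_le hm hanti a
    have hpos : 0 < modeGap hm p a := hgap.trans_le hle
    have hn1 : 384 * eliminationRate hm p a * Real.log (1 / δ) ≤ n :=
      (Nat.le_ceil _).trans (by exact_mod_cast le_trans (Nat.le_add_right _ _) hn)
    rw [logFactor_eq (by simpa using by omega) hδ (hn₀.trans hn0), Fintype.card_fin,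
      ← modeGap_of_ne hm p ha]
    have h1 : 384 * p ⟨0, by omega⟩ * Real.log (1 / δ) ≤ n * modeGap hm p a ^ 2 := by
      rw [← div_le_iff₀ (by positivity)]
      refine le_trans (le_of_eq ?_) hn1
      rw [eliminationRate]
      ring
    have h2 := hlog n hn0
    have h3 : modeGap hm p ⟨1, by omega⟩ ^ 2 ≤ modeGap hm p a ^ 2 := by gcongr
    nlinarith [mul_le_mul_of_nonneg_right h3 (Nat.cast_nonneg (α := ℝ) n)]

/-- The weight `p i` hides the crude value of `identifyBound` at classes of probability zero. -/
lemma mul_identifyBound {i : Fin m} (hp0 : 0 ≤ p i) (hp1 : p i ≤ 1) :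
    p i * identifyBound p i = p i * (2 * (⌈Real.logb 2 (1 / p i)⌉ : ℝ) + 3) := by
  by_cases h : p i = 0
  · simp [h]
  · have hpos : 0 < p i := lt_of_le_of_ne hp0 (Ne.symm h)
    have hlog : 0 ≤ Real.logb 2 (1 / p i) :=
      Real.logb_nonneg one_lt_two (by rwa [le_div_iff₀ hpos, one_mul])
    rw [identifyBound, if_neg h]
    push_cast
    rw [natCast_ceil_eq_intCast_ceil hlog]

lemma eliminationTime_le (hm : 2 ≤ m) (hp0 : ∀ i, 0 ≤ p i) (n₀ : ℕ) {δ : ℝ}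
    (hL : 0 ≤ Real.log (1 / δ)) (i : Fin m) :
    (eliminationTime hm p n₀ δ i : ℝ) ≤
      384 * eliminationRate hm p i * Real.log (1 / δ) + (n₀ + 1) := by
  have h := eliminationRate_nonneg hm hp0 i
  have := (Nat.ceil_lt_add_one (by positivity :
    0 ≤ 384 * eliminationRate hm p i * Real.log (1 / δ))).le
  rw [eliminationTime]
  push_cast
  linarith

/-- The part of the bound for the expected number of queries that does not depend on `δ`. -/
noncomputable def queryConst (p : Fin m → ℝ) (η : ℝ) (n₀ : ℕ) : ℝ :=
  (m + 1) * deviationBound m η + 2 * (n₀ + 1) + ∑ i, p i * (2 * (n₀ + 1) * identifyBound p i)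

/-- `1536 = 2 · 384 · 2` multiplies the logarithmic sum. The additive 3 in `identifyBound` gives
`2304 = 2 · 384 · 3` times the rate of the second class, since `∑ p i = 1`; the membership queries
add `768 = 2 · 384`. -/
lemma query_bound_le (hm : 2 ≤ m) (hp0 : ∀ i, 0 ≤ p i) (hp1 : ∑ i, p i = 1)
    (hanti : Antitone p) (hlt : ∀ i : Fin m, i ≠ ⟨0, by omega⟩ → p i < p ⟨0, by omega⟩)
    (η : ℝ) (n₀ : ℕ) {δ : ℝ} (hL : 0 ≤ Real.log (1 / δ)) :
    (m + 1) * deviationBound m η + 2 * eliminationTime hm p n₀ δ ⟨0, by omega⟩ +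
        ∑ i, p i * (2 * eliminationTime hm p n₀ δ i * identifyBound p i) ≤
      (3072 * eliminationRate hm p ⟨1, by omega⟩ +
        1536 * ∑ i, p i * eliminationRate hm p i * (⌈Real.logb 2 (1 / p i)⌉ : ℝ)) *
          Real.log (1 / δ) + queryConst p η n₀ := by
  set M := Real.log (1 / δ)
  set A := eliminationRate hm p
  have hp1' : ∀ i, p i ≤ 1 := fun i => by
    rw [← hp1]; exact Finset.single_le_sum (fun j _ => hp0 j) (Finset.mem_univ i)
  have h0 : (eliminationTime hm p n₀ δ ⟨0, by omega⟩ : ℝ) ≤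
      384 * A ⟨1, by omega⟩ * M + (n₀ + 1) := by
    refine (eliminationTime_le hm hp0 n₀ hL _).trans (le_of_eq ?_)
    rw [eliminationRate, modeGap_zero]
    rfl
  have hterm : ∀ i, p i * (2 * eliminationTime hm p n₀ δ i * identifyBound p i) ≤
      1536 * M * (p i * A i * (⌈Real.logb 2 (1 / p i)⌉ : ℝ)) +
        2304 * M * A ⟨1, by omega⟩ * p i + p i * (2 * (n₀ + 1) * identifyBound p i) := by
    intro i
    have h1 := eliminationTime_le hm hp0 n₀ hL i
    have h2 : 0 ≤ p i * identifyBound p i := mul_nonneg (hp0 i) (by positivity)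
    have h3 := mul_identifyBound (hp0 i) (hp1' i)
    have h4 := mul_le_mul_of_nonneg_left (eliminationRate_le hm hp0 hanti hlt i)
      (mul_nonneg hL (hp0 i))
    calc p i * (2 * eliminationTime hm p n₀ δ i * identifyBound p i)
        = 2 * (p i * identifyBound p i * eliminationTime hm p n₀ δ i) := by ring
      _ ≤ 2 * (p i * identifyBound p i * (384 * A i * M + (n₀ + 1))) := by gcongr
      _ = 768 * A i * M * (p i * identifyBound p i) +
            p i * (2 * (n₀ + 1) * identifyBound p i) := by ring
      _ = 1536 * M * (p i * A i * (⌈Real.logb 2 (1 / p i)⌉ : ℝ)) +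
            2304 * (M * p i * A i) + p i * (2 * (n₀ + 1) * identifyBound p i) := by
          rw [h3]; ring
      _ ≤ _ := by linarith
  have hsum := Finset.sum_le_sum fun i (_ : i ∈ Finset.univ) => hterm i
  rw [Finset.sum_add_distrib, Finset.sum_add_distrib, ← Finset.mul_sum, ← Finset.mul_sum, hp1,
    mul_one] at hsum
  rw [queryConst]
  linarith

end

end Elimination

/-! ### The main theorem -/

theorem mainTheorem2 :
    ∃ C₁ C₂ : ℝ, 0 < C₁ ∧ 0 < C₂ ∧
      ∀ (m : ℕ) (hm : 2 ≤ m) (p : Fin m → ℝ), p ∈ stdSimplex ℝ (Fin m) → Antitone p →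
        (∀ i : Fin m, i ≠ ⟨0, by omega⟩ → p i < p ⟨0, by omega⟩) →
        ∃ ε : ℝ → ℝ, Tendsto ε (𝓝[>] 0) (𝓝 0) ∧
          ∀ (Ω : Type*) [MeasurableSpace Ω] (P : Measure Ω) [IsProbabilityMeasure P]
            (Y : ℕ → Ω → Fin m),
            (∀ r, Measurable (Y r)) → iIndepFun Y P →
            (∀ r i, P.real {ω | Y r ω = i} = p i) →
            ∀ δ : ℝ, 0 < δ → ∀ τ : Elimination.TreeRule (Fin m),
              Elimination.IsHuffmanRule (Elimination.schedule (Fin m) δ) τ →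
              let success : Set Ω := {ω |
                Elimination.Returns (Elimination.schedule (Fin m) δ) (fun r => Y r ω) ⟨0, by omega⟩}
              let T : Ω → ℝ≥0∞ := fun ω =>
                Elimination.totalQueries (Elimination.schedule (Fin m) δ) τ (fun r => Y r ω)
              1 - δ ≤ P.real success ∧
              (δ < 1 →
                (∫⁻ ω, T ω ∂P[|success]) / ENNReal.ofReal (Real.log (1 / δ)) ≤
                  ENNReal.ofReal
                    (C₁ * (p ⟨0, by omega⟩ / modeGap hm p ⟨1, by omega⟩ ^ 2)
                      + C₂ * ∑ i, p i * (p ⟨0, by omega⟩ / modeGap hm p i ^ 2)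
                          * (⌈Real.logb 2 (1 / p i)⌉ : ℝ)
                      + ε δ)) := by
  refine ⟨3072, 1536, by norm_num, by norm_num, fun m hm p ⟨hp0, hp1⟩ hanti hlt => ?_⟩
  have hpb : 0 < p ⟨0, by omega⟩ :=
    (hp0 ⟨1, by omega⟩).trans_lt (hlt ⟨1, by omega⟩ (by simp [Fin.ext_iff]))
  obtain ⟨η, hη, hη1, hη2, hη3⟩ := Elimination.exists_gap hp0 hpb hlt
  obtain ⟨n₀, hn₀, hlog⟩ := Elimination.exists_forall_add_log_lt
    (192 * p ⟨0, by omega⟩ * Real.log (Real.pi ^ 2 * m)) (384 * p ⟨0, by omega⟩)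
    (half_pos (pow_pos (modeGap_one_pos hm hlt) 2))
  set X : ℝ := 3072 * (p ⟨0, by omega⟩ / modeGap hm p ⟨1, by omega⟩ ^ 2)
    + 1536 * ∑ i, p i * (p ⟨0, by omega⟩ / modeGap hm p i ^ 2) * (⌈Real.logb 2 (1 / p i)⌉ : ℝ)
    with hX
  set K := Elimination.queryConst p η n₀
  -- The error is the full bound minus its limit `X`. It involves only `X`, `K` and `δ`, and is
  -- fixed before the probability space and the tree rule.
  refine ⟨_, Elimination.tendsto_error X K, ?_⟩
  intro Ω _ P _ Y hY hindep hp δ hδ τ hτ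
  have hcard : 1 ≤ Fintype.card (Fin m) := by rw [Fintype.card_fin]; omega
  have helim := fun hδ1 : δ ≤ 1 =>
    Elimination.isEliminationTime hm hp0 hp1 hanti hlt hη hη1 hη2 hη3 hn₀ hlog hδ hδ1
  have hsucc : 1 - δ ≤ P.real {ω | Elimination.Returns (Elimination.schedule (Fin m) δ)
      (fun r => Y r ω) ⟨0, by omega⟩} := by
    rcases le_total δ 1 with hδ1 | hδ1
    · exact (helim hδ1).one_sub_le_measureReal_returns hcard hδ hδ1 hY hindep hp
    · exact (sub_nonpos.2 hδ1).trans measureReal_nonneg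
  refine ⟨hsucc, fun hδ1 => ?_⟩
  have hL : 0 < Real.log (1 / δ) := Real.log_pos (by rwa [lt_div_iff₀ hδ, one_mul])
  have hδ' : 0 < 1 - δ := sub_pos.2 hδ1
  have hint := (helim hδ1.le).setLIntegral_totalQueries_le hcard hδ hδ1.le hY hindep hp hτ
  rw [Fintype.card_fin] at hint
  have hint' := hint.trans (ENNReal.ofReal_le_ofReal
    (Elimination.query_bound_le hm hp0 hp1 hanti hlt η n₀ hL.le))
  have hinv : (P {ω | Elimination.Returns (Elimination.schedule (Fin m) δ)
      (fun r => Y r ω) ⟨0, by omega⟩})⁻¹ ≤ ENNReal.ofReal (1 - δ)⁻¹ := by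
    rw [ENNReal.ofReal_inv_of_pos hδ', ENNReal.inv_le_inv, ← ofReal_measureReal]
    exact ENNReal.ofReal_le_ofReal hsucc
  -- The conditional expectation is the integral over the success event divided by its probability,
  -- which is at least `1 - δ`.
  rw [add_sub_cancel, ProbabilityTheory.cond, lintegral_smul_measure, smul_eq_mul]
  calc _ ≤ ENNReal.ofReal (1 - δ)⁻¹ * ENNReal.ofReal (X * Real.log (1 / δ) + K) /
        ENNReal.ofReal (Real.log (1 / δ)) :=
        ENNReal.div_le_div_right (mul_le_mul' hinv hint') _
    _ = _ := by
        rw [← ENNReal.ofReal_mul (by positivity), ← ENNReal.ofReal_div_of_pos hL]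
        congr 1
        rw [← div_eq_inv_mul, div_div, mul_comm (1 - δ)]
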